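/- Let $\mathcal H_s$ be a complex Hilbert space of finite dimension $d$, let $\mathcal H_e$ be a complex Hilbert space, and put $\mathcal H=\mathcal H_s\otimes\mathcal H_e$. A decoupling set for $\mathcal H_s$ is a finite group $V$ of unitary operators on $\mathcal H_s$ such that $$\frac1{|V|}\sum_{v\in V} v x v^*=\frac1d\operatorname{tr}(x)\,\mathbf 1_{\mathcal H_s}\qquad\text{for all linear operators } x \text{ on } \mathcal H_s .$$ A decoupling cycle of length $N\ge 1$ is a finite sequence $(v_1,\dots,v_N)$ in $V$ in which every element of $V$ occurs the same number of times. For $v\in V$ write $v$ also for $v\otimes\mathbf 1_{\mathcal H_e}$. Theorem. Let $V$ be a decoupling set for $\mathcal H_s$ and let $H:\mathcal D(H)\to\mathcal H$, $\mathcal D(H)\subset\mathcal H$, be a (possibly unbounded) self-adjoint operator. If the operator $\sum_{v\in V} vHv^*$ with domain $\bigcap_{v\in V} v\,\mathcal D(H)$ is essentially self-adjoint, then dynamical decoupling works uniformly for $H$: there is a self-adjoint operator $B$ on $\mathcal H_e$ such that, for every decoupling cycle $(v_1,\dots,v_N)$ and every $\xi\in\mathcal H$, $$\lim_{n\to\infty}\Big(e^{i\frac{t}{nN}v_1Hv_1^*}\cdots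 e^{i\frac{t}{nN}v_NHv_N^*}\Big)^n\xi=e^{it(\mathbf 1_{\mathcal H_s}\otimes B)}\xi ,$$ uniformly for $t$ in compact subsets of $\mathbb R$. -/

import Mathlib

open scoped TensorProduct

namespace DynamicalDecoupling

/-- The tensor product of a finite-dimensional inner product space and a Hilbert space, with
Mathlib's inner product `⟪a ⊗ b, c ⊗ d⟫ = ⟪a, c⟫ * ⟪b, d⟫`, is already complete. -/
instance instCompleteSpaceTensor {E F : Type*} [NormedAddCommGroup E] [InnerProductSpace ℂ E]
    [FiniteDimensional ℂ E] [NormedAddCommGroup F] [InnerProductSpace ℂ F] [CompleteSpace F] :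
    CompleteSpace (E ⊗[ℂ] F) := by
  classical
  let b := stdOrthonormalBasis ℂ E
  let φ : PiLp 2 (fun _ : Fin (Module.finrank ℂ E) => F) →ₗ[ℂ] E ⊗[ℂ] F :=
    { toFun := fun y => ∑ i, b i ⊗ₜ[ℂ] y i
      map_add' := fun y z => by simp [TensorProduct.tmul_add, Finset.sum_add_distrib]
      map_smul' := fun c y => by simp [Finset.smul_sum] }
  have hφ : ∀ y, φ y = ∑ i, b i ⊗ₜ[ℂ] y i := fun _ => rfl
  have hinner : ∀ y z, inner ℂ (φ y) (φ z) = inner ℂ y z := fun y z => by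
    simp [hφ, sum_inner, inner_sum, b.inner_eq_ite, PiLp.inner_apply]
  let ψ : PiLp 2 (fun _ : Fin (Module.finrank ℂ E) => F) →ₗᵢ[ℂ] E ⊗[ℂ] F :=
    φ.isometryOfInner hinner
  have hsurj : Function.Surjective ψ := fun x => by
    induction x using TensorProduct.induction_on with
    | zero => exact ⟨0, map_zero _⟩
    | tmul e f =>
      refine ⟨WithLp.toLp 2 fun i => b.repr e i • f, ?_⟩
      change (∑ i, b i ⊗ₜ[ℂ] (b.repr e i • f)) = _
      simp_rw [← TensorProduct.smul_tmul, ← TensorProduct.sum_tmul]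
      rw [b.sum_repr]
    | add x y hx hy =>
      obtain ⟨a, rfl⟩ := hx
      obtain ⟨c, rfl⟩ := hy
      exact ⟨a + c, map_add _ _ _⟩
  let e := LinearIsometryEquiv.ofSurjective ψ hsurj
  exact (completeSpace_congr (e := e.toEquiv) e.isometry.isUniformEmbedding).1 inferInstance

section Operators

variable {E : Type*} [NormedAddCommGroup E] [InnerProductSpace ℂ E] [CompleteSpace E]

/-- `U` is a strongly continuous one-parameter group of unitaries on `E` whose generator is `iA`:
the derivative of `t ↦ U t x` at `0` exists exactly for `x` in the domain of `A`, and then it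
equals `i A x`. -/
structure IsUnitaryGroupOf (A : E →ₗ.[ℂ] E) (U : ℝ → E →L[ℂ] E) : Prop where
  mem_unitary : ∀ t, U t ∈ unitary (E →L[ℂ] E)
  map_zero : U 0 = 1
  map_add : ∀ s t, U (s + t) = U s * U t
  continuous : ∀ x, Continuous fun t => U t x
  generator : ∀ x y, (x, y) ∈ A.graph ↔ HasDerivAt (fun t => U t x) (Complex.I • y) 0

open Classical in
/-- `expI A t` is `e^{itA}`, for a self-adjoint (possibly unbounded) operator `A`: the value at `t`
of the strongly continuous unitary group with generator `iA`, which exists by Stone's theorem.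
For operators without such a group the value is `0`, which is not unitary unless `E` is trivial. -/
noncomputable def expI (A : E →ₗ.[ℂ] E) : ℝ → E →L[ℂ] E :=
  if h : ∃ U, IsUnitaryGroupOf A U then h.choose else 0

/-- `T` is essentially self-adjoint: it is closable with self-adjoint closure. -/
def IsEssentiallySelfAdjoint (T : E →ₗ.[ℂ] E) : Prop :=
  T.IsClosable ∧ IsSelfAdjoint T.closure


/-- The operator `u A u*`, for a unitary `u`, on its domain `u 𝒟(A)`. -/
noncomputable def conj (u : E ≃ₗᵢ[ℂ] E) (A : E →ₗ.[ℂ] E) : E →ₗ.[ℂ] E where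
  domain := A.domain.map (u.toLinearEquiv : E →ₗ[ℂ] E)
  toFun := (u.toLinearEquiv : E →ₗ[ℂ] E) ∘ₗ A.toFun ∘ₗ
    ((u.toLinearEquiv.submoduleMap A.domain).symm : _ →ₗ[ℂ] A.domain)

end Operators

section Decoupling

variable {Hs He : Type*} [NormedAddCommGroup Hs] [InnerProductSpace ℂ Hs] [FiniteDimensional ℂ Hs]
  [NormedAddCommGroup He] [InnerProductSpace ℂ He] [CompleteSpace He]

/-- A finite group `V` of unitaries of `Hs` (linear isometric bijections; the adjoint of `v` is
`v⁻¹`) is a decoupling set if `|V|⁻¹ ∑ v x v* = d⁻¹ tr(x) 1` for all linear operators `x` on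
`Hs`, where `d` is the dimension of `Hs`. -/
def IsDecouplingSet (V : Subgroup (Hs ≃ₗᵢ[ℂ] Hs)) [Fintype V] : Prop :=
  ∀ x : Hs →ₗ[ℂ] Hs,
    (Fintype.card V : ℂ)⁻¹ • ∑ v : V,
        (v.1.toLinearEquiv : Hs →ₗ[ℂ] Hs) ∘ₗ x ∘ₗ ((v.1⁻¹).toLinearEquiv : Hs →ₗ[ℂ] Hs) =
      ((Module.finrank ℂ Hs : ℂ)⁻¹ * LinearMap.trace ℂ Hs x) • LinearMap.id

/-- A decoupling cycle `(c 0, …, c (N - 1))` of positive length `N`: it reaches each element of `V`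
the same number `m ≥ 1` of times (so that `N = m * |V|`). -/
def IsDecouplingCycle (V : Subgroup (Hs ≃ₗᵢ[ℂ] Hs)) {N : ℕ} (c : Fin N → V) : Prop :=
  ∃ m : ℕ, 0 < m ∧ ∀ v : V, Nat.card {k : Fin N // c k = v} = m

/-- `(v ⊗ 1) H (v ⊗ 1)*` on the domain `(v ⊗ 1) 𝒟(H)`. -/
noncomputable def conjSys (v : Hs ≃ₗᵢ[ℂ] Hs) (H : (Hs ⊗[ℂ] He) →ₗ.[ℂ] (Hs ⊗[ℂ] He)) :
    (Hs ⊗[ℂ] He) →ₗ.[ℂ] (Hs ⊗[ℂ] He) :=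
  conj (v.rTensor He) H

/-- `∑_{v ∈ V} (v ⊗ 1) H (v ⊗ 1)*` on the domain `⋂_{v ∈ V} (v ⊗ 1) 𝒟(H)`. -/
noncomputable def conjSum (V : Subgroup (Hs ≃ₗᵢ[ℂ] Hs)) [Fintype V]
    (H : (Hs ⊗[ℂ] He) →ₗ.[ℂ] (Hs ⊗[ℂ] He)) : (Hs ⊗[ℂ] He) →ₗ.[ℂ] (Hs ⊗[ℂ] He) where
  domain := ⨅ v : V, (conjSys v.1 H).domain
  toFun := ∑ v : V, (conjSys v.1 H).toFun ∘ₗ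
    Submodule.inclusion (iInf_le (fun v : V => (conjSys v.1 H).domain) v)

variable (Hs) in
/-- `1 ⊗ B` on the domain `Hs ⊗ 𝒟(B)`, with `(1 ⊗ B) (x ⊗ y) = x ⊗ B y`. Since `Hs` is
finite-dimensional, no closure has to be taken. -/
noncomputable def oneTensor (B : He →ₗ.[ℂ] He) : (Hs ⊗[ℂ] He) →ₗ.[ℂ] (Hs ⊗[ℂ] He) where
  domain := LinearMap.range (B.domain.subtype.lTensor Hs)
  toFun := B.toFun.lTensor Hs ∘ₗ
    ((LinearEquiv.ofInjective (B.domain.subtype.lTensor Hs)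
      (Module.Flat.lTensor_preserves_injective_linearMap B.domain.subtype
        B.domain.injective_subtype)).symm : _ →ₗ[ℂ] Hs ⊗[ℂ] B.domain)

/-- `(e^{i t/(nN) v₁ H v₁*} ⋯ e^{i t/(nN) v_N H v_N*})^n` for the cycle `c = (v₁, …, v_N)`. -/
noncomputable def decouplingProduct {V : Subgroup (Hs ≃ₗᵢ[ℂ] Hs)}
    (H : (Hs ⊗[ℂ] He) →ₗ.[ℂ] (Hs ⊗[ℂ] He)) {N : ℕ} (c : Fin N → V) (n : ℕ) (t : ℝ) :
    (Hs ⊗[ℂ] He) →L[ℂ] (Hs ⊗[ℂ] He) :=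
  (List.ofFn fun k : Fin N => expI (conjSys (c k).1 H) (t / (n * N))).prod ^ n

/-- Dynamical decoupling works uniformly: there is one self-adjoint `B` on `He` such that for every
decoupling cycle the products converge strongly to `e^{it(1 ⊗ B)}`, uniformly for `t` in compact
sets. -/
def WorksUniformly (V : Subgroup (Hs ≃ₗᵢ[ℂ] Hs)) (H : (Hs ⊗[ℂ] He) →ₗ.[ℂ] (Hs ⊗[ℂ] He)) : Prop :=
  ∃ B : He →ₗ.[ℂ] He, IsSelfAdjoint B ∧
    ∀ (N : ℕ) (c : Fin N → V), IsDecouplingCycle V c →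
      ∀ (ξ : Hs ⊗[ℂ] He) (K : Set ℝ), IsCompact K →
        TendstoUniformlyOn (fun (n : ℕ) (t : ℝ) => decouplingProduct H c n t ξ)
          (fun t => expI (oneTensor Hs B) t ξ) Filter.atTop K

end Decoupling

end DynamicalDecoupling

/-! The self-adjoint closure of `∑ v H v*`, divided by `|V|`, is an operator `C` that depends on `V`
and `H` only, not on the cycle. Two independent facts give the theorem: `C` has the form `1 ⊗ B`,
and the products converge to `e^{itC}`.

Form of `C`. Conjugation by `w ∈ V` permutes the summands `v H v*`, so the graph of the sum is
`V`-invariant, and so are its closure and the graph of `C`. The decoupling identity for rank one `x`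
writes every `|a⟩⟨b|` as a linear combination of elements of `V` (`IsDecouplingSet.sum_inner_smul`).
A graph is a linear subspace, so that of `C` is invariant under all `|a⟩⟨b| ⊗ 1`. These matrix units
force `C = 1 ⊗ B`, where `B` is read off on `e ⊗ He` for one unit vector `e`
(`exists_oneTensor_eq`).

Convergence. On `⋂ v 𝒟(H)` the product `F(h)` of the `N` exponentials with time `h/N` has derivative
`iC` at `0`, since each `v` occurs equally often. Essential self-adjointness makes this intersection
a core for `C`, so Chernoff's formula gives `F(t/n)^n → e^{itC}` (`tendstoUniformlyOn_pow_of_core`).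
Chernoff's formula rests on a comparison of the resolvents of `h⁻¹(F(h) - 1)` with that of the
generator (`norm_pow_apply_sub_le`). The groups themselves come from Stone's theorem, by Yosida
approximation. -/

namespace DynamicalDecoupling

open Filter Topology

/-! ### Self-adjointness through graphs, and resolvents -/

section SelfAdjoint

variable {E : Type*} [NormedAddCommGroup E] [InnerProductSpace ℂ E] [CompleteSpace E]

/-- This is `A = A*` read on graphs. Working with pairs `(x, y)` in the graph avoids vectors of the
domain as a subtype. -/
theorem mem_graph_iff_of_isSelfAdjoint {A : E →ₗ.[ℂ] E} (hA : IsSelfAdjoint A) (x y : E) :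
    (x, y) ∈ A.graph ↔ ∀ a b, (a, b) ∈ A.graph → inner ℂ b x = inner ℂ a y := by
  have h : A.graph = A.graph.adjoint := by
    rw [← LinearPMap.adjoint_graph_eq_graph_adjoint hA.dense_domain,
      LinearPMap.isSelfAdjoint_def.1 hA]
  conv_lhs => rw [h]
  simp only [Submodule.mem_adjoint_iff, sub_eq_zero]

theorem isSelfAdjoint_of_mem_graph_iff {A : E →ₗ.[ℂ] E} (hd : Dense (A.domain : Set E))
    (h : ∀ x y, (x, y) ∈ A.graph ↔ ∀ a b, (a, b) ∈ A.graph → inner ℂ b x = inner ℂ a y) :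
    IsSelfAdjoint A := by
  rw [LinearPMap.isSelfAdjoint_def]
  apply LinearPMap.eq_of_eq_graph
  rw [LinearPMap.adjoint_graph_eq_graph_adjoint hd]
  ext ⟨x, y⟩
  rw [h]
  simp only [Submodule.mem_adjoint_iff, sub_eq_zero]

theorem inner_eq_inner_of_mem_graph {A : E →ₗ.[ℂ] E} (hA : IsSelfAdjoint A) {x y a b : E}
    (h : (x, y) ∈ A.graph) (h' : (a, b) ∈ A.graph) : inner ℂ y a = inner ℂ x b :=
  (mem_graph_iff_of_isSelfAdjoint hA a b).1 h' x y h

omit [CompleteSpace E] in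
-- Symmetry makes `⟪y, x⟫` real, so the cross term with `iμx` has no real part.
theorem norm_sub_I_smul_sq {x y : E} (h : inner ℂ y x = inner ℂ x y) (μ : ℝ) :
    ‖y - (μ * Complex.I) • x‖ ^ 2 = ‖y‖ ^ 2 + μ ^ 2 * ‖x‖ ^ 2 := by
  have him : (inner ℂ y x).im = 0 := by
    have h1 := congrArg Complex.im h
    rw [← inner_conj_symm x y, Complex.conj_im] at h1
    linarith
  have h2 := @norm_sub_sq ℂ E _ _ _ y ((μ * Complex.I) • x)
  rw [h2, inner_smul_right, norm_smul]
  simp [him, mul_pow]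

/-- The resolvent `(A - iμ)⁻¹` of a self-adjoint operator. -/
structure IsResolvent (A : E →ₗ.[ℂ] E) (μ : ℝ) (R : E →L[ℂ] E) : Prop where
  mem_graph : ∀ x, (R x, x + (μ * Complex.I) • R x) ∈ A.graph
  apply_eq : ∀ x y, (x, y) ∈ A.graph → R (y - (μ * Complex.I) • x) = x
  norm_le : ∀ x, ‖R x‖ ≤ |μ|⁻¹ * ‖x‖

/-- By `norm_sub_I_smul_sq`, `A - iμ` is bounded below on the graph, which is complete. Its range is
therefore closed, and a vector orthogonal to the range would be an eigenvector for `-iμ`, impossible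
for a symmetric operator. -/
theorem exists_isResolvent {A : E →ₗ.[ℂ] E} (hA : IsSelfAdjoint A) {μ : ℝ} (hμ : μ ≠ 0) :
    ∃ R, IsResolvent A μ R := by
  have hclosed : IsClosed (A.graph : Set (E × E)) := hA.isClosed
  have : CompleteSpace A.graph := hclosed.completeSpace_coe
  let T : A.graph →L[ℂ] E :=
    (ContinuousLinearMap.snd ℂ E E - (μ * Complex.I) • ContinuousLinearMap.fst ℂ E E) ∘L
      A.graph.subtypeL
  have hT : ∀ p, T p = p.1.2 - (μ * Complex.I) • p.1.1 := fun _ => rfl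
  have hsq : ∀ p : A.graph, ‖T p‖ ^ 2 = ‖p.1.2‖ ^ 2 + μ ^ 2 * ‖p.1.1‖ ^ 2 := fun p => by
    rw [hT]
    exact norm_sub_I_smul_sq (inner_eq_inner_of_mem_graph hA p.2 p.2) μ
  have hfst : ∀ p : A.graph, |μ| * ‖p.1.1‖ ≤ ‖T p‖ := fun p => by
    refine abs_le_of_sq_le_sq' ?_ (norm_nonneg _) |>.2
    rw [hsq, mul_pow, sq_abs]
    nlinarith [sq_nonneg ‖p.1.2‖]
  have hsnd : ∀ p : A.graph, ‖p.1.2‖ ≤ ‖T p‖ := fun p => by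
    refine abs_le_of_sq_le_sq' ?_ (norm_nonneg _) |>.2
    rw [hsq]
    nlinarith [sq_nonneg (μ * ‖p.1.1‖)]
  have hμ' : 0 < |μ| := abs_pos.2 hμ
  have hbound : ∀ p : A.graph, ‖p‖ ≤ (|μ|⁻¹ + 1) * ‖T p‖ := fun p => by
    have h1 : ‖p.1.1‖ ≤ |μ|⁻¹ * ‖T p‖ := by
      rw [inv_mul_eq_div, le_div_iff₀ hμ', mul_comm]
      exact hfst p
    have h2 := hsnd p
    have h3 : 0 ≤ |μ|⁻¹ * ‖T p‖ := by positivity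
    change max ‖p.1.1‖ ‖p.1.2‖ ≤ _
    rw [max_le_iff]
    constructor <;> nlinarith [norm_nonneg (T p)]
  have hanti : AntilipschitzWith (|μ|⁻¹ + 1).toNNReal T :=
    T.antilipschitz_of_bound fun p => by
      rw [Real.coe_toNNReal _ (by positivity)]
      exact hbound p
  have hker : LinearMap.ker T.toLinearMap = ⊥ := LinearMap.ker_eq_bot.2 hanti.injective
  have hrange : LinearMap.range T.toLinearMap = ⊤ := by
    have hcl : IsClosed (LinearMap.range T.toLinearMap : Set E) := by
      rw [LinearMap.coe_range]
      exact hanti.isClosed_range T.uniformContinuous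
    have : CompleteSpace (LinearMap.range T.toLinearMap) := hcl.completeSpace_coe
    rw [← Submodule.orthogonal_eq_bot_iff, Submodule.eq_bot_iff]
    intro w hw
    rw [Submodule.mem_orthogonal] at hw
    have hmem : (w, (-(μ * Complex.I)) • w) ∈ A.graph := by
      rw [mem_graph_iff_of_isSelfAdjoint hA]
      intro a b hab
      have := hw _ ⟨⟨(a, b), hab⟩, rfl⟩
      change inner ℂ (b - (μ * Complex.I) • a) w = 0 at this
      rw [inner_sub_left, inner_smul_left, sub_eq_zero] at this
      rw [this, inner_smul_right]
      simp
    have h1 := hfst ⟨_, hmem⟩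
    have h2 := hw _ ⟨⟨_, hmem⟩, rfl⟩
    have h4 := inner_eq_inner_of_mem_graph hA hmem hmem
    rw [inner_smul_left, inner_smul_right] at h4
    have h3 : (μ : ℂ) * Complex.I * inner ℂ w w = 0 := by
      simp only [map_neg, map_mul, Complex.conj_ofReal, Complex.conj_I] at h4
      linear_combination h4 / 2
    have h5 : (μ : ℂ) ≠ 0 := by exact_mod_cast hμ
    simpa [h5] using h3
  let e := ContinuousLinearEquiv.ofBijective T hker hrange
  have he : ∀ p, e p = T p := fun _ => rfl
  refine ⟨ContinuousLinearMap.fst ℂ E E ∘L A.graph.subtypeL ∘L (e.symm : E →L[ℂ] A.graph),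
    ?_, ?_, ?_⟩
  · intro x
    have h := (e.apply_symm_apply x)
    rw [he, hT] at h
    change ((e.symm x).1.1, x + (μ * Complex.I) • (e.symm x).1.1) ∈ A.graph
    nth_rewrite 2 [← h]
    simp
  · intro x y h
    change (e.symm (y - (μ * Complex.I) • x)).1.1 = x
    have : e.symm (y - (μ * Complex.I) • x) = ⟨(x, y), h⟩ := by
      rw [ContinuousLinearEquiv.symm_apply_eq, he, hT]
    rw [this]
  · intro x
    change ‖(e.symm x).1.1‖ ≤ _
    have h := hfst (e.symm x)
    rw [← he, e.apply_symm_apply] at h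
    rwa [inv_mul_eq_div, le_div_iff₀ hμ', mul_comm]

namespace IsResolvent

variable {A : E →ₗ.[ℂ] E} {μ ν : ℝ} {R S : E →L[ℂ] E}

omit [CompleteSpace E] in
theorem resolvent_identity (hR : IsResolvent A μ R) (hS : IsResolvent A ν S) (x : E) :
    R x = S x + ((μ - ν) * Complex.I) • S (R x) := by
  have h := hS.apply_eq _ _ (hR.mem_graph x)
  rw [← map_smul S, ← map_add S]
  conv_lhs => rw [← h]
  congr 1
  module

omit [CompleteSpace E] in
-- Adding the resolvent identity to the one with `R` and `S` exchanged leaves `(μ - ν)i (S R - R S)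
-- = 0`; for `μ = ν` the identity says `R = S`.
theorem commute (hR : IsResolvent A μ R) (hS : IsResolvent A ν S) : Commute R S := by
  by_cases h : μ = ν
  · subst h
    have : R = S := by
      ext x
      simpa using hR.resolvent_identity hS x
    rw [this]
  · ext x
    have h1 := hR.resolvent_identity hS x
    have h2 := hS.resolvent_identity hR x
    have h3 : ((μ - ν) * Complex.I) • (R (S x) - S (R x)) = 0 := by
      have : ((μ - ν) * Complex.I) • (R (S x) - S (R x)) =
        (R x - (S x + ((μ - ν) * Complex.I) • S (R x))) +
          (S x - (R x + ((ν - μ) * Complex.I) • R (S x))) := by module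
      rw [this, ← h1, ← h2, sub_self, sub_self, add_zero]
    have h4 : (μ : ℂ) - ν ≠ 0 := by
      rw [sub_ne_zero]; exact_mod_cast h
    rw [smul_eq_zero, sub_eq_zero] at h3
    simpa [h4] using h3

theorem adjoint_eq (hA : IsSelfAdjoint A) (hR : IsResolvent A μ R) (hS : IsResolvent A (-μ) S) :
    ContinuousLinearMap.adjoint R = S := by
  symm
  rw [ContinuousLinearMap.eq_adjoint_iff]
  intro x y
  have h := inner_eq_inner_of_mem_graph hA (hS.mem_graph x) (hR.mem_graph y)
  rw [inner_add_left, inner_add_right, inner_smul_left, inner_smul_right] at h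
  simp only [map_mul, Complex.conj_ofReal, Complex.conj_I] at h
  push_cast at h
  linear_combination -h

end IsResolvent

end SelfAdjoint

/-! ### Strong limits of contractions -/

section Contractions

variable {E : Type*} [NormedAddCommGroup E] [InnerProductSpace ℂ E]

/-- Contractions are equicontinuous, so an `ε/3` argument reduces every limit to a dense set, such
as a domain or the range of a resolvent. -/
theorem tendstoUniformlyOn_of_dense {ι τ : Type*} {l : Filter ι} {K : Set τ}
    {F : ι → τ → E →L[ℂ] E} {G : τ → E →L[ℂ] E} (hF : ∀ i t x, ‖F i t x‖ ≤ ‖x‖)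
    (hG : ∀ t x, ‖G t x‖ ≤ ‖x‖) {D : Set E} (hD : Dense D)
    (h : ∀ x ∈ D, TendstoUniformlyOn (fun i t => F i t x) (fun t => G t x) l K) (x : E) :
    TendstoUniformlyOn (fun i t => F i t x) (fun t => G t x) l K := by
  rw [Metric.tendstoUniformlyOn_iff]
  intro ε hε
  obtain ⟨y, hy, hxy⟩ := hD.exists_dist_lt x (show 0 < ε / 3 by positivity)
  have h1 := Metric.tendstoUniformlyOn_iff.1 (h y hy) (ε / 3) (by positivity)
  filter_upwards [h1] with i hi t ht
  have h2 := hi t ht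
  rw [dist_eq_norm] at *
  have h3 := hF i t (x - y)
  have h4 := hG t (x - y)
  rw [map_sub] at h3 h4
  have : G t x - F i t x = (G t x - G t y) + (G t y - F i t y) - (F i t x - F i t y) := by abel
  rw [this]
  have h5 := norm_sub_le ((G t x - G t y) + (G t y - F i t y)) (F i t x - F i t y)
  have h6 := norm_add_le (G t x - G t y) (G t y - F i t y)
  linarith

theorem tendsto_of_dense {ι : Type*} {l : Filter ι} {F : ι → E →L[ℂ] E} {G : E →L[ℂ] E}
    (hF : ∀ i x, ‖F i x‖ ≤ ‖x‖) (hG : ∀ x, ‖G x‖ ≤ ‖x‖) {D : Set E} (hD : Dense D)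
    (h : ∀ x ∈ D, Tendsto (fun i => F i x) l (𝓝 (G x))) (x : E) :
    Tendsto (fun i => F i x) l (𝓝 (G x)) := by
  have := tendstoUniformlyOn_of_dense (τ := Unit) (l := l) (K := {()}) (F := fun i _ => F i)
    (G := fun _ => G) (fun i _ => hF i) (fun _ => hG) hD
    (fun x hx => tendstoUniformlyOn_singleton_iff_tendsto.2 (h x hx)) x
  exact (tendstoUniformlyOn_singleton_iff_tendsto (F := fun i (_ : Unit) => F i x)
    (f := fun _ => G x)).1 this

theorem cauchySeq_of_dense {F : ℕ → E →L[ℂ] E} (hF : ∀ i x, ‖F i x‖ ≤ ‖x‖) {D : Set E}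
    (hD : Dense D) (h : ∀ x ∈ D, CauchySeq fun i => F i x) (x : E) :
    CauchySeq fun i => F i x := by
  rw [Metric.cauchySeq_iff]
  intro ε hε
  obtain ⟨y, hy, hxy⟩ := hD.exists_dist_lt x (show 0 < ε / 3 by positivity)
  obtain ⟨N, hN⟩ := Metric.cauchySeq_iff.1 (h y hy) (ε / 3) (by positivity)
  refine ⟨N, fun m hm n hn => ?_⟩
  have h2 := hN m hm n hn
  rw [dist_eq_norm] at *
  have h3 := hF m (x - y)
  have h4 := hF n (x - y)
  rw [map_sub] at h3 h4
  have : F m x - F n x = (F m x - F m y) + (F m y - F n y) - (F n x - F n y) := by abel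
  rw [this]
  have h5 := norm_sub_le ((F m x - F m y) + (F m y - F n y)) (F n x - F n y)
  have h6 := norm_add_le (F m x - F m y) (F m y - F n y)
  linarith

theorem tendsto_apply_of_tendsto {ι : Type*} {l : Filter ι} {F : ι → E →L[ℂ] E}
    {G : E →L[ℂ] E} (hF : ∀ i x, ‖F i x‖ ≤ ‖x‖)
    (h : ∀ x, Tendsto (fun i => F i x) l (𝓝 (G x))) {u : ι → E} {v : E}
    (hu : Tendsto u l (𝓝 v)) : Tendsto (fun i => F i (u i)) l (𝓝 (G v)) := by
  have h1 : Tendsto (fun i => F i (u i - v)) l (𝓝 0) := by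
    refine squeeze_zero_norm (fun i => hF i _) ?_
    rw [← tendsto_sub_nhds_zero_iff] at hu
    simpa using hu.norm
  have h2 := h1.add (h v)
  simpa using h2

end Contractions

/-! ### Stone's theorem -/

section Stone

variable {E : Type*} [NormedAddCommGroup E] [InnerProductSpace ℂ E] [CompleteSpace E]

/-- Yosida approximation: the generator `iA` is a strong limit of commuting bounded skew-adjoint
operators on its domain. -/
theorem exists_yosida {A : E →ₗ.[ℂ] E} (hA : IsSelfAdjoint A) :
    ∃ B : ℕ → E →L[ℂ] E, (∀ n, B n ∈ skewAdjoint (E →L[ℂ] E)) ∧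
      (∀ n m, Commute (B n) (B m)) ∧
      ∀ x y, (x, y) ∈ A.graph → Tendsto (fun n => B n x) atTop (𝓝 (Complex.I • y)) := by
  have hpos : ∀ n : ℕ, (0 : ℝ) < n + 1 := fun n => by positivity
  choose R hR using fun n : ℕ => exists_isResolvent hA (hpos n).ne'
  choose S hS using fun n : ℕ => exists_isResolvent hA (neg_ne_zero.2 (hpos n).ne')
  have hRn : ∀ n x, ‖R n x‖ ≤ ((n : ℝ) + 1)⁻¹ * ‖x‖ := fun n x => by
    simpa [abs_of_pos (hpos n)] using (hR n).norm_le x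
  have hSn : ∀ n x, ‖S n x‖ ≤ ((n : ℝ) + 1)⁻¹ * ‖x‖ := fun n x => by
    have := (hS n).norm_le x
    rwa [abs_neg, abs_of_pos (hpos n)] at this
  have hR0 : ∀ (n : ℕ) x y, (x, y) ∈ A.graph →
      (((n : ℝ) + 1 : ℝ) * Complex.I) • R n x = R n y - x := fun n x y h => by
    have := (hR n).apply_eq _ _ h
    rw [map_sub, map_smul] at this
    rw [← sub_eq_zero]
    rw [← sub_eq_zero] at this
    rw [← neg_eq_zero, ← this]
    abel
  have hS0 : ∀ (n : ℕ) x y, (x, y) ∈ A.graph →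
      (((n : ℝ) + 1 : ℝ) * Complex.I) • S n x = x - S n y := fun n x y h => by
    have := (hS n).apply_eq _ _ h
    rw [map_sub, map_smul] at this
    rw [← sub_eq_zero]
    rw [← sub_eq_zero] at this
    rw [← this]
    push_cast
    module
  -- With `μ = n + 1`, `R = (A - iμ)⁻¹` and `S = (A + iμ)⁻¹`, the operator `T` is `iμ²(A² + μ²)⁻¹`,
  -- a contraction tending strongly to `i`. The approximant `(iμ²/2)(R + S) = iμ²A(A² + μ²)⁻¹`
  -- equals `T A` on the domain, and is skew-adjoint because `R* = S`.
  let c : ℕ → ℂ := fun n => (((n : ℝ) + 1 : ℝ) : ℂ)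
  let T : ℕ → E →L[ℂ] E := fun n => (c n / 2) • (R n - S n)
  have hTn : ∀ n x, ‖T n x‖ ≤ ‖x‖ := fun n x => by
    have h1 : ‖c n / 2‖ = ((n : ℝ) + 1) / 2 := by
      rw [norm_div, Complex.norm_real, Real.norm_of_nonneg (hpos n).le]
      simp
    have h2 : ‖R n x - S n x‖ ≤ 2 * (((n : ℝ) + 1)⁻¹ * ‖x‖) := by
      have := norm_sub_le (R n x) (S n x)
      linarith [hRn n x, hSn n x]
    change ‖(c n / 2) • (R n x - S n x)‖ ≤ _
    rw [norm_smul, h1]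
    calc _ ≤ ((n : ℝ) + 1) / 2 * (2 * (((n : ℝ) + 1)⁻¹ * ‖x‖)) := by gcongr
      _ = ‖x‖ := by field_simp
  have hTlim : ∀ y, Tendsto (fun n => T n y) atTop
      (𝓝 ((Complex.I • (1 : E →L[ℂ] E)) y)) := by
    refine tendsto_of_dense hTn (fun x => by simp [norm_smul]) hA.dense_domain ?_
    intro y hy
    obtain ⟨z, hz⟩ := LinearPMap.mem_domain_iff.1 hy
    have h1 : ∀ n, T n y = Complex.I • y - (Complex.I / 2) • (R n z + S n z) := fun n => by
      have h3 := hR0 n y z hz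
      have h4 := hS0 n y z hz
      change (c n / 2) • (R n y - S n y) = _
      have : (c n / 2) • (R n y - S n y) =
          (-Complex.I / 2) • ((c n * Complex.I) • R n y - (c n * Complex.I) • S n y) := by
        rw [← smul_sub, smul_smul]
        congr 1
        linear_combination (c n / 2) * Complex.I_sq
      rw [this, h3, h4]
      module
    have h2 : Tendsto (fun n => R n z + S n z) atTop (𝓝 0) := by
      have h3 : Tendsto (fun n : ℕ => 2 * (((n : ℝ) + 1)⁻¹ * ‖z‖)) atTop (𝓝 0) := by
        have := (tendsto_one_div_add_atTop_nhds_zero_nat (𝕜 := ℝ)).mul_const ‖z‖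
        have := this.const_mul 2
        simpa using this
      refine squeeze_zero_norm (fun n => ?_) h3
      have := norm_add_le (R n z) (S n z)
      linarith [hRn n z, hSn n z]
    have h5 := (tendsto_const_nhds (x := Complex.I • y)).sub (h2.const_smul (Complex.I / 2))
    simp only [smul_zero, sub_zero] at h5
    simp only [h1]
    simpa using h5
  refine ⟨fun n => Complex.I • (c n ^ 2 / 2) • (R n + S n), fun n => ?_, fun n m => ?_, ?_⟩
  · have h1 : star (R n) = S n := (hR n).adjoint_eq hA (hS n)
    have h2 : star (S n) = R n := by rw [← h1, star_star]
    rw [skewAdjoint.mem_iff, star_smul, star_smul, star_add, h1, h2]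
    simp [c, add_comm]
  · have h : Commute (R n + S n) (R m + S m) :=
      (((hR n).commute (hR m)).add_left ((hS n).commute (hR m))).add_right
        (((hR n).commute (hS m)).add_left ((hS n).commute (hS m)))
    exact (((h.smul_left _).smul_left _).smul_right _).smul_right _
  · intro x y h
    have h1 : ∀ n, (Complex.I • (c n ^ 2 / 2) • (R n + S n)) x = T n y := fun n => by
      change Complex.I • (c n ^ 2 / 2) • (R n x + S n x) = (c n / 2) • (R n y - S n y)
      have h3 := hR0 n x y h
      have h4 := hS0 n x y h
      have : Complex.I • (c n ^ 2 / 2) • (R n x + S n x) =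
          (c n / 2) • ((c n * Complex.I) • R n x + (c n * Complex.I) • S n x) := by module
      rw [this, h3, h4]
      module
    simp only [h1]
    simpa using hTlim y

variable {B C : E →L[ℂ] E}

theorem exp_smul_mem_unitary (hB : B ∈ skewAdjoint (E →L[ℂ] E)) (t : ℝ) :
    NormedSpace.exp (t • B) ∈ unitary (E →L[ℂ] E) :=
  let : NormedAlgebra ℚ (E →L[ℂ] E) := NormedAlgebra.restrictScalars ℚ ℂ _
  NormedSpace.exp_mem_unitary_of_mem_skewAdjoint (skewAdjoint.smul_mem t hB)

theorem norm_apply_of_mem_unitary {U : E →L[ℂ] E} (hU : U ∈ unitary (E →L[ℂ] E)) (x : E) :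
    ‖U x‖ = ‖x‖ :=
  (Unitary.norm_map ⟨U, hU⟩ x)

theorem hasDerivAt_exp_smul_apply (B : E →L[ℂ] E) (x : E) (t : ℝ) :
    HasDerivAt (fun s : ℝ => NormedSpace.exp (s • B) x) (NormedSpace.exp (t • B) (B x)) t :=
  ((ContinuousLinearMap.apply ℂ E x).restrictScalars ℝ).hasFDerivAt.comp_hasDerivAt t
    (hasDerivAt_exp_smul_const (𝕂 := ℝ) B t)

theorem norm_exp_smul_apply_sub_self_le (hB : B ∈ skewAdjoint (E →L[ℂ] E)) (x : E) (t : ℝ) :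
    ‖NormedSpace.exp (t • B) x - x‖ ≤ |t| * ‖B x‖ := by
  have h := Convex.norm_image_sub_le_of_norm_hasDerivWithin_le (𝕜 := ℝ)
    (f := fun s : ℝ => NormedSpace.exp (s • B) x) (s := Set.univ) (x := 0) (y := t) (C := ‖B x‖)
    (fun s _ => (hasDerivAt_exp_smul_apply B x s).hasDerivWithinAt)
    (fun s _ => (norm_apply_of_mem_unitary (exp_smul_mem_unitary hB s) _).le)
    convex_univ trivial trivial
  simpa [mul_comm] using h

/-- Since `B` and `C` commute, `e^{tB} = e^{tC} e^{t(B - C)}`, and the unitary factor `e^{tC}` does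
not change norms. This makes the Yosida groups Cauchy on the domain, uniformly for bounded `t`. -/
theorem norm_exp_smul_apply_sub_le (hB : B ∈ skewAdjoint (E →L[ℂ] E))
    (hC : C ∈ skewAdjoint (E →L[ℂ] E)) (h : Commute B C) (x : E) (t : ℝ) :
    ‖NormedSpace.exp (t • B) x - NormedSpace.exp (t • C) x‖ ≤ |t| * ‖B x - C x‖ := by
  let : NormedAlgebra ℚ (E →L[ℂ] E) := NormedAlgebra.restrictScalars ℚ ℂ _
  have h1 : NormedSpace.exp (t • B) =
      NormedSpace.exp (t • C) * NormedSpace.exp (t • (B - C)) := by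
    have h2 : Commute C (B - C) := h.symm.sub_right (Commute.refl C)
    rw [← NormedSpace.exp_add_of_commute ((h2.smul_left t).smul_right t)]
    congr 1
    module
  rw [h1, mul_apply_eq_comp, ← map_sub,
    norm_apply_of_mem_unitary (exp_smul_mem_unitary hC t)]
  exact norm_exp_smul_apply_sub_self_le (sub_mem hB hC) x t

/-- Stone's theorem: a self-adjoint operator generates a unitary group. -/
theorem exists_isUnitaryGroupOf {A : E →ₗ.[ℂ] E} (hA : IsSelfAdjoint A) :
    ∃ U, IsUnitaryGroupOf A U := by
  let : NormedAlgebra ℚ (E →L[ℂ] E) := NormedAlgebra.restrictScalars ℚ ℂ _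
  obtain ⟨B, hskew, hcomm, hlim⟩ := exists_yosida hA
  let W : ℕ → ℝ → E →L[ℂ] E := fun n t => NormedSpace.exp (t • B n)
  have hWu : ∀ n t, W n t ∈ unitary (E →L[ℂ] E) := fun n t => exp_smul_mem_unitary (hskew n) t
  have hWn : ∀ n t x, ‖W n t x‖ = ‖x‖ := fun n t x => norm_apply_of_mem_unitary (hWu n t) x
  have hWadd : ∀ n s t, W n (s + t) = W n s * W n t := fun n s t => by
    change NormedSpace.exp _ = NormedSpace.exp _ * NormedSpace.exp _
    rw [add_smul, NormedSpace.exp_add_of_commute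
      (((Commute.refl (B n)).smul_left s).smul_right t)]
  have hdiff : ∀ n m t x, ‖W n t x - W m t x‖ ≤ |t| * ‖B n x - B m x‖ := fun n m t x =>
    norm_exp_smul_apply_sub_le (hskew n) (hskew m) (hcomm n m) x t
  have hcauchy : ∀ t x, CauchySeq fun n => W n t x := fun t => by
    refine cauchySeq_of_dense (fun n x => (hWn n t x).le) hA.dense_domain ?_
    intro x hx
    obtain ⟨y, hy⟩ := LinearPMap.mem_domain_iff.1 hx
    rw [Metric.cauchySeq_iff]
    intro ε hε
    obtain ⟨N, hN⟩ := Metric.cauchySeq_iff.1 (hlim x y hy).cauchySeq (ε / (|t| + 1))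
      (by positivity)
    refine ⟨N, fun m hm n hn => ?_⟩
    have h1 := hN m hm n hn
    rw [dist_eq_norm, lt_div_iff₀ (by positivity)] at h1
    rw [dist_eq_norm]
    refine (hdiff m n t x).trans_lt ?_
    nlinarith [norm_nonneg (B m x - B n x)]
  choose u hu using fun t x => cauchySeq_tendsto_of_complete (hcauchy t x)
  let U : ℝ → E →L[ℂ] E := fun t =>
    continuousLinearMapOfTendsto (fun n => W n t) (f := u t) (tendsto_pi_nhds.2 (hu t))
  have hU : ∀ t x, Tendsto (fun n => W n t x) atTop (𝓝 (U t x)) := hu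
  have hUn : ∀ t x, ‖U t x‖ = ‖x‖ := fun t x =>
    tendsto_nhds_unique (hU t x).norm (by simp [hWn])
  have hzero : U 0 = 1 := by
    ext x
    refine tendsto_nhds_unique (hU 0 x) ?_
    simp [W]
  have hadd : ∀ s t, U (s + t) = U s * U t := fun s t => by
    ext x
    refine tendsto_nhds_unique (hU (s + t) x) ?_
    simp only [hWadd]
    exact tendsto_apply_of_tendsto (fun n x => (hWn n s x).le) (hU s) (hU t x)
  have hadj : ∀ t, ContinuousLinearMap.adjoint (U t) = U (-t) := fun t => by
    symm
    rw [ContinuousLinearMap.eq_adjoint_iff]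
    intro x y
    have h1 := (hU (-t) x).inner (𝕜 := ℂ) (tendsto_const_nhds (x := y))
    have h2 := (tendsto_const_nhds (x := x)).inner (𝕜 := ℂ) (hU t y)
    refine tendsto_nhds_unique h1 ?_
    -- Taking adjoints is not strongly continuous, so the adjoint is computed for each `W n t`,
    -- where it is `W n (-t)`, and the limit is taken in the inner products.
    convert h2 using 2 with n
    have h3 : star (W n t) * W n t = 1 := (Unitary.mem_iff.1 (hWu n t)).1
    have h4 : W n t * W n (-t) = 1 := by
      rw [← hWadd]
      simp [W]
    have h5 : star (W n t) = W n (-t) := by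
      calc star (W n t) = star (W n t) * (W n t * W n (-t)) := by rw [h4, mul_one]
        _ = W n (-t) := by rw [← mul_assoc, h3, one_mul]
    rw [← h5]
    exact ContinuousLinearMap.adjoint_inner_left _ _ _
  have hunit : ∀ t, U t ∈ unitary (E →L[ℂ] E) := fun t => by
    rw [Unitary.mem_iff, ContinuousLinearMap.star_eq_adjoint, hadj, ← hadd, ← hadd]
    simp [hzero]
  have hle : ∀ n t x y, (x, y) ∈ A.graph → ‖W n t x - U t x‖ ≤ |t| * ‖B n x - Complex.I • y‖ := by
    intro n t x y hxy
    have h1 := ((tendsto_const_nhds (x := W n t x)).sub (hU t x)).norm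
    have h2 := ((tendsto_const_nhds (x := B n x)).sub (hlim x y hxy)).norm.const_mul |t|
    exact le_of_tendsto_of_tendsto' h1 h2 fun m => hdiff n m t x
  have hunif : ∀ (r : ℝ) x, TendstoUniformlyOn (fun n t => W n t x) (fun t => U t x) atTop
      (Metric.ball 0 r) := by
    intro r
    refine tendstoUniformlyOn_of_dense (fun n t x => (hWn n t x).le) (fun t x => (hUn t x).le)
      hA.dense_domain ?_
    intro x hx
    obtain ⟨y, hy⟩ := LinearPMap.mem_domain_iff.1 hx
    have h1 : Tendsto (fun n => |r| * ‖B n x - Complex.I • y‖) atTop (𝓝 0) := by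
      have := ((hlim x y hy).sub_const (Complex.I • y)).norm.const_mul |r|
      simpa using this
    rw [Metric.tendstoUniformlyOn_iff]
    intro ε hε
    filter_upwards [h1.eventually_lt_const hε] with n hn t ht
    rw [dist_comm, dist_eq_norm]
    refine (hle n t x y hy).trans_lt (lt_of_le_of_lt ?_ hn)
    rw [mem_ball_zero_iff, Real.norm_eq_abs] at ht
    exact mul_le_mul_of_nonneg_right (ht.le.trans (le_abs_self r)) (norm_nonneg _)
  have hcont : ∀ x, Continuous fun t => U t x := fun x => by
    rw [continuous_iff_continuousAt]
    intro t
    have h1 : ContinuousOn (fun t => U t x) (Metric.ball 0 (|t| + 1)) := by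
      refine (hunif (|t| + 1) x).continuousOn (Eventually.frequently (Eventually.of_forall ?_))
      intro n
      exact fun s _ => (hasDerivAt_exp_smul_apply (B n) x s).continuousAt.continuousWithinAt
    exact h1.continuousAt (Metric.isOpen_ball.mem_nhds (by simp))
  have hderiv : ∀ x y, (x, y) ∈ A.graph → HasDerivAt (fun t => U t x) (Complex.I • y) 0 := by
    intro x y hxy
    -- The derivatives of `t ↦ W n t x` converge uniformly near `0`, so the limit may be
    -- differentiated.
    have h1 : TendstoUniformlyOn (fun n t => W n t (B n x)) (fun t => U t (Complex.I • y)) atTop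
        (Metric.ball 0 1) := by
      have h2 := Metric.tendstoUniformlyOn_iff.1 (hunif 1 (Complex.I • y))
      rw [Metric.tendstoUniformlyOn_iff]
      intro ε hε
      filter_upwards [h2 (ε / 2) (by positivity),
        (Metric.tendsto_nhds.1 (hlim x y hxy)) (ε / 2) (by positivity)] with n hn hn' t ht
      have h3 := hn t ht
      have h4 : dist (W n t (Complex.I • y)) (W n t (B n x)) < ε / 2 := by
        rw [dist_eq_norm, ← map_sub, hWn, ← dist_eq_norm, dist_comm]
        exact hn'
      have := dist_triangle (U t (Complex.I • y)) (W n t (Complex.I • y)) (W n t (B n x))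
      linarith
    have h := hasDerivAt_of_tendstoUniformlyOn (x := (0 : ℝ)) Metric.isOpen_ball h1
      (Eventually.of_forall fun n t _ => hasDerivAt_exp_smul_apply (B n) x t)
      (fun t _ => hU t x) (by simp)
    simpa [hzero] using h
  refine ⟨U, hunit, hzero, hadd, hcont, fun x y => ⟨hderiv x y, fun h => ?_⟩⟩
  -- Converse: differentiating the constant `⟪U t a, U t x⟫` at `0` for `(a, b)` in the graph places
  -- `(x, y)` in the graph of `A* = A`.
  rw [mem_graph_iff_of_isSelfAdjoint hA]
  intro a b hab
  have h1 := (hderiv a b hab).inner ℂ h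
  have h2 : (fun t => inner ℂ (U t a) (U t x)) = fun _ => inner ℂ a x := by
    ext t
    exact Unitary.inner_map_map ⟨U t, hunit t⟩ a x
  rw [h2] at h1
  have h3 := h1.unique (hasDerivAt_const _ _)
  simp only [hzero, one_apply_eq_self, inner_smul_left, inner_smul_right,
    Complex.conj_I] at h3
  have h4 : Complex.I * (inner ℂ a y - inner ℂ b x) = 0 := by linear_combination h3
  rw [mul_eq_zero, sub_eq_zero] at h4
  exact (h4.resolve_left Complex.I_ne_zero).symm

theorem isUnitaryGroupOf_expI {A : E →ₗ.[ℂ] E} (h : ∃ U, IsUnitaryGroupOf A U) :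
    IsUnitaryGroupOf A (expI A) := by
  rw [expI, dif_pos h]
  exact h.choose_spec

end Stone

/-! ### Chernoff's product formula for contractions -/

section Chernoff

variable {E : Type*} [NormedAddCommGroup E] [InnerProductSpace ℂ E]

theorem tendstoUniformlyOn_of_isCompact {ι : Type*} {l : Filter ι} {F : ι → E →L[ℂ] E}
    {G : E →L[ℂ] E} (hF : ∀ i x, ‖F i x‖ ≤ ‖x‖) (hG : ∀ x, ‖G x‖ ≤ ‖x‖)
    (h : ∀ x, Tendsto (fun i => F i x) l (𝓝 (G x))) {K : Set E} (hK : IsCompact K) :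
    TendstoUniformlyOn (fun i x => F i x) G l K := by
  rw [← tendstoLocallyUniformlyOn_iff_tendstoUniformlyOn_of_compact hK,
    Metric.tendstoLocallyUniformlyOn_iff]
  intro ε hε x _
  refine ⟨Metric.ball x (ε / 3),
    mem_nhdsWithin_of_mem_nhds (Metric.ball_mem_nhds x (by positivity)), ?_⟩
  filter_upwards [Metric.tendsto_nhds.1 (h x) (ε / 3) (by positivity)] with i hi y hy
  rw [Metric.mem_ball] at hy
  rw [dist_eq_norm] at *
  have h3 := hF i (y - x)
  have h4 := hG (y - x)
  rw [map_sub] at h3 h4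
  have : G y - F i y = (G y - G x) - (F i x - G x) - (F i y - F i x) := by abel
  rw [this]
  have h5 := norm_sub_le ((G y - G x) - (F i x - G x)) (F i y - F i x)
  have h6 := norm_sub_le (G y - G x) (F i x - G x)
  linarith

theorem norm_pow_apply_le {F : E →L[ℂ] E} (hF : ∀ x, ‖F x‖ ≤ ‖x‖) (n : ℕ) (x : E) :
    ‖(F ^ n) x‖ ≤ ‖x‖ := by
  induction n generalizing x with
  | zero => simp
  | succ n ih =>
    rw [pow_succ]
    exact (ih (F x)).trans (hF x)

/-- The resolvent at `1` of the difference quotient `h⁻¹ (F - 1)` of a contraction `F`. -/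
theorem exists_resolvent_of_contraction [CompleteSpace E] {F : E →L[ℂ] E}
    (hF : ∀ x, ‖F x‖ ≤ ‖x‖) {h : ℝ} (hh : 0 < h) :
    ∃ R : E →L[ℂ] E, (∀ x, ‖R x‖ ≤ ‖x‖) ∧ (∀ x, F (R x) = R x + h • (R x - x)) ∧
      ∀ x, R (x - h⁻¹ • (F x - x)) = x := by
  have hh1 : (0 : ℝ) < 1 + h := by positivity
  -- The resolvent is `(1 - h⁻¹(F - 1))⁻¹ = h(1 + h)⁻¹ (1 - (1 + h)⁻¹F)⁻¹`, a Neumann series.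
  have hlt : ‖(1 + h)⁻¹ • F‖ < 1 := by
    have h1 : ‖F‖ ≤ 1 := F.opNorm_le_bound zero_le_one fun x => by simpa using hF x
    rw [norm_smul, norm_inv, Real.norm_of_nonneg hh1.le, inv_mul_lt_iff₀ hh1]
    linarith
  let u : (E →L[ℂ] E)ˣ := Units.oneSub _ hlt
  have hu : ∀ x, (u : E →L[ℂ] E) x = x - (1 + h)⁻¹ • F x := fun x => rfl
  let R : E →L[ℂ] E := (h * (1 + h)⁻¹) • (↑u⁻¹ : E →L[ℂ] E)
  have hRx : ∀ x, R x = (h * (1 + h)⁻¹) • (↑u⁻¹ : E →L[ℂ] E) x := fun x => rfl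
  have hleft : ∀ x, (↑u⁻¹ : E →L[ℂ] E) ((u : E →L[ℂ] E) x) = x := fun x =>
    DFunLike.congr_fun (Units.inv_mul u) x
  have hright : ∀ x, (u : E →L[ℂ] E) ((↑u⁻¹ : E →L[ℂ] E) x) = x := fun x =>
    DFunLike.congr_fun (Units.mul_inv u) x
  have hFR : ∀ x, F (R x) = R x + h • (R x - x) := fun x => by
    have h1 : (u : E →L[ℂ] E) (R x) = (h * (1 + h)⁻¹) • x := by
      rw [hRx, ← Complex.coe_smul, map_smul, hright, Complex.coe_smul]
    rw [hu] at h1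
    have h2 : (1 + h) • (R x - (1 + h)⁻¹ • F (R x)) = h • x := by
      rw [h1, smul_smul]
      congr 1
      field_simp
    rw [smul_sub, smul_smul, mul_inv_cancel₀ hh1.ne', one_smul, sub_eq_iff_eq_add] at h2
    rw [smul_sub]
    rw [add_smul, one_smul] at h2
    rw [← add_sub_assoc, h2]
    abel
  refine ⟨R, fun x => ?_, hFR, fun x => ?_⟩
  · have h1 : (1 + h) • R x = F (R x) + h • x := by
      rw [hFR]
      module
    have h2 := congrArg norm h1
    rw [norm_smul, Real.norm_of_nonneg hh1.le] at h2
    have h3 := norm_add_le (F (R x)) (h • x)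
    rw [norm_smul, Real.norm_of_nonneg hh.le] at h3
    have h4 := hF (R x)
    nlinarith
  · have h1 : x - h⁻¹ • (F x - x) = (h⁻¹ * (1 + h)) • (u : E →L[ℂ] E) x := by
      rw [hu]
      match_scalars <;> field_simp
      ring
    rw [h1, ← Complex.coe_smul, map_smul, Complex.coe_smul, hRx, hleft, smul_smul]
    have : h⁻¹ * (1 + h) * (h * (1 + h)⁻¹) = 1 := by field_simp
    rw [this, one_smul]

variable {W : ℝ → E →L[ℂ] E} {R : E →L[ℂ] E}

/-- Discrete form of the Trotter-Kato comparison of `F ^ n` and `W (n h)`. -/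
theorem norm_pow_apply_sub_le {F Rh : E →L[ℂ] E} {h ε : ℝ} (hh : 0 < h)
    (hF : ∀ x, ‖F x‖ ≤ ‖x‖) (hRh : ∀ x, ‖Rh x‖ ≤ ‖x‖)
    (hFR : ∀ x, F (Rh x) = Rh x + h • (Rh x - x))
    (hW : ∀ t x, ‖W t x‖ ≤ ‖x‖) (hW0 : W 0 = 1) (hWadd : ∀ s t, W (s + t) = W s * W t)
    (hWR : ∀ t x, R (W t x) = W t (R x)) (x : E) (n : ℕ)
    (h1 : ∀ k : ℕ, k < n → ‖Rh (W (k * h) x) - R (W (k * h) x)‖ ≤ ε)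
    (h2 : ‖W h (R x) - R x - h • (R x - x)‖ ≤ ε * h) :
    ‖(F ^ n) (Rh (R x)) - Rh (W (n * h) (R x))‖ ≤ n * h * (2 * ε) := by
  induction n with
  | zero => simp [hW0]
  | succ n ih =>
    have hε : ‖Rh (W (n * h) x) - R (W (n * h) x)‖ ≤ ε := h1 n (Nat.lt_succ_self n)
    have ih' := ih fun k hk => h1 k (hk.trans (Nat.lt_succ_self n))
    set z := W (n * h) x with hz
    have hcomm : ∀ s y, W s (W (n * h) y) = W (n * h) (W s y) := fun s y => by
      rw [← mul_apply_eq_comp, ← mul_apply_eq_comp, ← hWadd, ← hWadd, add_comm]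
    have hzR : W (n * h) (R x) = R z := (hWR _ _).symm
    have hstep : W ((n + 1 : ℕ) * h) (R x) = W h (R z) := by
      rw [← hzR, show ((n + 1 : ℕ) : ℝ) * h = h + n * h by push_cast; ring, hWadd]
      rfl
    -- `W (n * h)` commutes with `W h` and `R`, so the consistency error at time `n * h` is the
    -- image of the one at time `0`.
    have he : ‖W h (R z) - R z - h • (R z - z)‖ ≤ ε * h := by
      have : W h (R z) - R z - h • (R z - z) =
          W (n * h) (W h (R x) - R x - h • (R x - x)) := by
        rw [← Complex.coe_smul, ← Complex.coe_smul, map_sub, map_sub, map_smul, map_sub, ← hcomm,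
          hzR]
      rw [this]
      exact (hW _ _).trans h2
    -- The one-step error is `h` times the difference of resolvents minus `Rh` of the consistency
    -- error. Each has norm at most `ε * h`, hence the factor `2 * ε`.
    have hid : F (Rh (R z)) - Rh (W h (R z)) =
        h • (Rh z - R z) - Rh (W h (R z) - R z - h • (R z - z)) := by
      rw [hFR, map_sub, map_sub, ← Complex.coe_smul, ← Complex.coe_smul, ← Complex.coe_smul,
        map_smul, map_sub]
      module
    have hlocal : ‖F (Rh (R z)) - Rh (W h (R z))‖ ≤ h * (2 * ε) := by
      rw [hid]
      refine (norm_sub_le _ _).trans ?_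
      have h3 := (hRh _).trans he
      rw [norm_smul, Real.norm_of_nonneg hh.le]
      nlinarith
    have hsplit : (F ^ (n + 1)) (Rh (R x)) - Rh (W ((n + 1 : ℕ) * h) (R x)) =
        F ((F ^ n) (Rh (R x)) - Rh (W (n * h) (R x))) + (F (Rh (R z)) - Rh (W h (R z))) := by
      rw [pow_succ', mul_apply_eq_comp, hstep, map_sub, hzR]
      abel
    rw [hsplit]
    refine (norm_add_le _ _).trans ?_
    have h4 := (hF _).trans ih'
    rw [Nat.cast_succ]
    linarith

/-- Chernoff's product formula for contractions, on positive times. Here `R` is the resolvent at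
`1` of the generator of `W`, and `D` is the graph of the generator on a core. -/
theorem tendstoUniformlyOn_pow_Icc [CompleteSpace E] {F : ℝ → E →L[ℂ] E}
    (hF : ∀ h x, ‖F h x‖ ≤ ‖x‖) (hF0 : F 0 = 1)
    (hW : ∀ t x, ‖W t x‖ ≤ ‖x‖) (hW0 : W 0 = 1) (hWadd : ∀ s t, W (s + t) = W s * W t)
    (hWc : ∀ x, Continuous fun t => W t x)
    (hR : ∀ x, ‖R x‖ ≤ ‖x‖) (hWR : ∀ t x, R (W t x) = W t (R x)) (hRd : DenseRange R)
    (hgen : ∀ x, HasDerivAt (fun t => W t (R x)) (R x - x) 0) {D : Set (E × E)}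
    (hD : ∀ p ∈ D, HasDerivAt (fun h => F h p.1) p.2 0) (hRD : ∀ p ∈ D, R (p.1 - p.2) = p.1)
    (hDd : Dense ((fun p : E × E => p.1 - p.2) '' D)) (T : ℝ) (x : E) :
    TendstoUniformlyOn (fun (n : ℕ) t => (F (t / n) ^ n) x) (fun t => W t x) atTop
      (Set.Icc 0 T) := by
  have hRh : ∀ h : ℝ, ∃ Rh : E →L[ℂ] E, (∀ x, ‖Rh x‖ ≤ ‖x‖) ∧ (0 < h →
      (∀ x, F h (Rh x) = Rh x + h • (Rh x - x)) ∧ ∀ x, Rh (x - h⁻¹ • (F h x - x)) = x) := by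
    intro h
    by_cases hh : 0 < h
    · obtain ⟨Rh, h1, h2⟩ := exists_resolvent_of_contraction (hF h) hh
      exact ⟨Rh, h1, fun _ => h2⟩
    -- Only `h > 0` matters; the value `0` keeps the family contractive for all `h`.
    · exact ⟨0, fun x => by simp, fun h' => absurd h' hh⟩
  choose S hS hS' using hRh
  have hlim : ∀ x, Tendsto (fun h => S h x) (𝓝[>] 0) (𝓝 (R x)) := by
    refine tendsto_of_dense hS hR hDd ?_
    rintro _ ⟨p, hp, rfl⟩
    have h1 := (hasDerivAt_iff_tendsto_slope_zero.1 (hD p hp)).mono_left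
      (nhdsWithin_mono 0 (fun h (hh : 0 < h) => hh.ne' : Set.Ioi (0 : ℝ) ⊆ {0}ᶜ))
    simp only [zero_add, hF0, one_apply_eq_self] at h1
    rw [hRD p hp, tendsto_iff_norm_sub_tendsto_zero]
    rw [tendsto_iff_norm_sub_tendsto_zero] at h1
    refine squeeze_zero' (Eventually.of_forall fun _ => norm_nonneg _) ?_ h1
    filter_upwards [self_mem_nhdsWithin] with h hh
    have h2 := (hS' h hh).2 p.1
    -- Convergence of the difference quotients on the core becomes strong convergence of the
    -- resolvents, first on the dense set of all `p.1 - p.2`.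
    have h3 : S h (p.1 - p.2) - p.1 = S h ((h⁻¹ • (F h p.1 - p.1)) - p.2) := by
      nth_rewrite 2 [← h2]
      rw [← map_sub]
      congr 1
      abel
    rw [h3]
    exact hS _ _
  -- Vectors `R (R x)` suffice: one `R` makes the orbit differentiable, the other is exchanged for
  -- `S h`.
  have hdense : Dense (Set.range fun x => R (R x)) :=
    hRd.comp hRd R.continuous
  refine tendstoUniformlyOn_of_dense (fun n t x => norm_pow_apply_le (hF _) n x) hW hdense ?_ x
  rintro _ ⟨x, rfl⟩
  -- The orbit of `x` over `[0, T]` is compact, so the resolvents converge uniformly along it.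
  have hunif : ∀ x, TendstoUniformlyOn (fun h s => S h (W s x)) (fun s => R (W s x)) (𝓝[>] 0)
      (Set.Icc 0 T) := fun x =>
    ((tendstoUniformlyOn_of_isCompact hS hR hlim
      (isCompact_Icc.image (hWc x) : IsCompact ((fun t => W t x) '' Set.Icc 0 T))).comp
        (fun t => W t x)).mono (Set.subset_preimage_image _ _)
  rw [Metric.tendstoUniformlyOn_iff]
  intro ε hε
  by_cases hT : 0 ≤ T
  swap
  · exact Eventually.of_forall fun n t ht => absurd (ht.1.trans ht.2) hT
  -- The accumulated error is at most `T * (2 * η)`; exchanging `R` for `S (t / n)` at each end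
  -- costs a further `η`.
  obtain ⟨η, hη, hηε⟩ : ∃ η > 0, 2 * η + T * (2 * η) < ε := by
    refine ⟨ε / (2 * (2 + 2 * T)), by positivity, ?_⟩
    have : 2 * (ε / (2 * (2 + 2 * T))) + T * (2 * (ε / (2 * (2 + 2 * T)))) = ε / 2 := by
      field_simp
    linarith
  have hder : ∀ᶠ h in 𝓝[>] (0 : ℝ), ‖W h (R x) - R x - h • (R x - x)‖ ≤ η * h := by
    have h1 := (hasDerivAt_iff_isLittleO.1 (hgen x)).def hη
    filter_upwards [h1.filter_mono nhdsWithin_le_nhds, self_mem_nhdsWithin] with h hh hpos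
    simpa [hW0, Real.norm_of_nonneg (le_of_lt hpos)] using hh
  have hev := ((Metric.tendstoUniformlyOn_iff.1 (hunif x) η hη).and
    (Metric.tendstoUniformlyOn_iff.1 (hunif (R x)) η hη)).and hder
  obtain ⟨δ, hδ, hδ'⟩ := (mem_nhdsGT_iff_exists_Ioo_subset).1 hev
  have hδ0 : 0 < δ := hδ
  obtain ⟨N, hN⟩ := exists_nat_gt (T / δ)
  filter_upwards [eventually_ge_atTop (N + 1)] with n hn t ht
  have hn0 : (0 : ℝ) < n := by
    have : 0 < n := by omega
    exact_mod_cast this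
  rcases ht.1.eq_or_lt with rfl | ht0
  · simp [hF0, hW0, hε]
  have hh : 0 < t / n := by positivity
  have hhδ : t / n < δ := by
    have h1 : (N : ℝ) < n := by exact_mod_cast hn
    rw [div_lt_iff₀ hδ0] at hN
    rw [div_lt_iff₀ hn0]
    nlinarith [ht.2]
  obtain ⟨⟨h1, h2⟩, h3⟩ := hδ' ⟨hh, hhδ⟩
  have hnt : n * (t / n) = t := by field_simp
  have h4 := norm_pow_apply_sub_le hh (hF _) (hS _) (hS' _ hh).1 hW hW0 hWadd hWR x n
    (fun k hk => by
      have hk' : (k : ℝ) < n := by exact_mod_cast hk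
      have h5 := h1 (k * (t / n)) ⟨by positivity, by
        have : k * (t / n) ≤ n * (t / n) := by gcongr
        linarith [ht.2]⟩
      rw [dist_comm, dist_eq_norm] at h5
      exact h5.le) h3
  rw [hnt] at h4
  have h5 : ‖(F (t / n) ^ n) (R (R x) - S (t / n) (R x))‖ < η := by
    have h6 := h2 0 ⟨le_rfl, hT⟩
    rw [hW0, dist_eq_norm] at h6
    exact (norm_pow_apply_le (hF _) n _).trans_lt h6
  have h7 := h2 t ht
  rw [dist_eq_norm] at h7
  have h8 : W t (R (R x)) - (F (t / n) ^ n) (R (R x)) =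
      (R (W t (R x)) - S (t / n) (W t (R x))) -
        ((F (t / n) ^ n) (S (t / n) (R x)) - S (t / n) (W t (R x))) -
          (F (t / n) ^ n) (R (R x) - S (t / n) (R x)) := by
    rw [hWR, map_sub]
    abel
  rw [dist_eq_norm, h8]
  refine (norm_sub_le _ _).trans_lt ?_
  have h9 := norm_sub_le (R (W t (R x)) - S (t / n) (W t (R x)))
    ((F (t / n) ^ n) (S (t / n) (R x)) - S (t / n) (W t (R x)))
  have h10 : t * (2 * η) ≤ T * (2 * η) := by
    have := ht.2
    gcongr
  linarith

end Chernoff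

/-! ### Unitary groups, cores and derivatives of products -/

section Trotter

variable {E : Type*} [NormedAddCommGroup E] [InnerProductSpace ℂ E] [CompleteSpace E]

omit [CompleteSpace E] in
theorem hasDerivAt_comp_const_mul {f : ℝ → E} {y : E} (h : HasDerivAt f y 0) (c : ℝ) :
    HasDerivAt (fun t => f (c * t)) (c • y) 0 := by
  have h1 : HasDerivAt (fun t : ℝ => c * t) c 0 := by
    simpa using (hasDerivAt_id (0 : ℝ)).const_mul c
  exact HasDerivAt.scomp (0 : ℝ) (h := fun t => c * t) (by simpa using h) h1

omit [CompleteSpace E] in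
theorem mem_graph_conj_iff (u : E ≃ₗᵢ[ℂ] E) (A : E →ₗ.[ℂ] E) (x y : E) :
    (x, y) ∈ (conj u A).graph ↔ (u.symm x, u.symm y) ∈ A.graph := by
  have key : ∀ a : A.domain, ∀ h : u a ∈ (conj u A).domain, conj u A ⟨u a, h⟩ = u (A a) := by
    intro a h
    change u (A ((u.toLinearEquiv.submoduleMap A.domain).symm ⟨u a, h⟩)) = _
    congr 2
    rw [LinearEquiv.symm_apply_eq]
    rfl
  simp only [LinearPMap.mem_graph_iff]
  constructor
  · rintro ⟨⟨_, a, ha, rfl⟩, rfl, rfl⟩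
    refine ⟨⟨a, ha⟩, (u.symm_apply_apply a).symm, ?_⟩
    rw [LinearIsometryEquiv.eq_symm_apply]
    exact (key ⟨a, ha⟩ _).symm
  · rintro ⟨a, ha, hy⟩
    rw [LinearIsometryEquiv.eq_symm_apply] at ha hy
    exact ⟨⟨u a, a, a.2, rfl⟩, ha, (key a _).trans hy⟩

namespace IsUnitaryGroupOf

variable {A : E →ₗ.[ℂ] E} {W : ℝ → E →L[ℂ] E}

theorem norm_apply (hW : IsUnitaryGroupOf A W) (t : ℝ) (x : E) : ‖W t x‖ = ‖x‖ :=
  norm_apply_of_mem_unitary (hW.mem_unitary t) x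

theorem apply_apply_comm (hW : IsUnitaryGroupOf A W) (s t : ℝ) (x : E) :
    W s (W t x) = W t (W s x) := by
  have h : W s * W t = W t * W s :=
    (hW.map_add s t).symm.trans ((congrArg W (add_comm s t)).trans (hW.map_add t s))
  exact DFunLike.congr_fun h x

theorem apply_mem_graph (hW : IsUnitaryGroupOf A W) (t : ℝ) {x y : E} (h : (x, y) ∈ A.graph) :
    (W t x, W t y) ∈ A.graph := by
  rw [hW.generator] at h ⊢
  have h1 := ((W t).restrictScalars ℝ).hasFDerivAt.comp_hasDerivAt (0 : ℝ) h
  rw [← map_smul]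
  refine h1.congr_of_eventuallyEq (Eventually.of_forall fun s => ?_)
  exact hW.apply_apply_comm s t x

theorem resolvent_apply (hW : IsUnitaryGroupOf A W) {μ : ℝ} {R : E →L[ℂ] E}
    (hR : IsResolvent A μ R) (t : ℝ) (x : E) : R (W t x) = W t (R x) := by
  have h := hR.apply_eq _ _ (hW.apply_mem_graph t (hR.mem_graph x))
  rw [_root_.map_add, map_smul, add_sub_cancel_right] at h
  exact h

/-- The group `u U u*` is generated by `u A u*`. -/
theorem conj (hW : IsUnitaryGroupOf A W) (u : E ≃ₗᵢ[ℂ] E) :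
    IsUnitaryGroupOf (conj u A)
      fun t => (u : E →L[ℂ] E) ∘L W t ∘L (u.symm : E →L[ℂ] E) where
  mem_unitary t :=
    mul_mem (Unitary.linearIsometryEquiv.symm u).2
      (mul_mem (hW.mem_unitary t) (Unitary.linearIsometryEquiv.symm u.symm).2)
  map_zero := by
    ext x
    simp [hW.map_zero]
  map_add s t := by
    ext x
    simp [hW.map_add]
  continuous x := u.continuous.comp (hW.continuous _)
  generator x y := by
    rw [mem_graph_conj_iff, hW.generator]
    constructor
    · intro h
      have h1 := ((u : E →L[ℂ] E).restrictScalars ℝ).hasFDerivAt.comp_hasDerivAt (0 : ℝ) h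
      simpa [Function.comp_def] using h1
    · intro h
      have h1 := ((u.symm : E →L[ℂ] E).restrictScalars ℝ).hasFDerivAt.comp_hasDerivAt (0 : ℝ) h
      simpa [Function.comp_def] using h1

end IsUnitaryGroupOf

/-- The sign `σ` covers negative times: `t ↦ W (σ * t)` has generator `iσA`, whose resolvent at `1`
is `(1 - iσA)⁻¹ = iσ(A + iσ)⁻¹`. This is why `R'` is taken at `μ = -σ`. -/
theorem tendstoUniformlyOn_pow_Icc_of_core {A : E →ₗ.[ℂ] E} (hA : IsSelfAdjoint A)
    {W : ℝ → E →L[ℂ] E} (hW : IsUnitaryGroupOf A W) {D : Set (E × E)}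
    (hDA : D ⊆ A.graph) (hAD : (A.graph : Set (E × E)) ⊆ closure D) {F : ℝ → E →L[ℂ] E}
    (hF : ∀ h x, ‖F h x‖ ≤ ‖x‖) (hF0 : F 0 = 1)
    (hD : ∀ x y, (x, y) ∈ D → HasDerivAt (fun h => F h x) (Complex.I • y) 0)
    {σ : ℝ} (hσ : σ = 1 ∨ σ = -1) (T : ℝ) (x : E) :
    TendstoUniformlyOn (fun (n : ℕ) t => (F (σ * (t / n)) ^ n) x) (fun t => W (σ * t) x) atTop
      (Set.Icc 0 T) := by
  have hσσ : (σ : ℂ) * σ = 1 := by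
    rcases hσ with rfl | rfl <;> simp
  have hσ0 : σ ≠ 0 := by rcases hσ with rfl | rfl <;> simp
  have hσn : |σ| = 1 := by rcases hσ with rfl | rfl <;> simp
  obtain ⟨R', hR'⟩ := exists_isResolvent hA (neg_ne_zero.2 hσ0)
  have hinv : ∀ x y, (x, y) ∈ A.graph → ((σ : ℂ) * Complex.I) • R' (x - (σ * Complex.I) • y) = x := by
    intro x y h
    have h1 := hR'.apply_eq _ _ h
    have h2 : ((σ : ℂ) * Complex.I) • (x - (σ * Complex.I) • y) =
        y - (((-σ : ℝ) : ℂ) * Complex.I) • x := by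
      match_scalars
      · ring
      · linear_combination (-Complex.I ^ 2) * hσσ - Complex.I_sq
    rw [← map_smul, h2, h1]
  refine tendstoUniformlyOn_pow_Icc (F := fun h => F (σ * h)) (W := fun t => W (σ * t))
    (R := (σ * Complex.I) • R') (D := (fun p : E × E => (p.1, (σ * Complex.I) • p.2)) '' D)
    (fun h => hF _) (by simpa using hF0) (fun t x => (hW.norm_apply _ x).le)
    (by simpa using hW.map_zero) (fun s t => by rw [mul_add, hW.map_add])
    (fun x => (hW.continuous x).comp (continuous_const.mul continuous_id)) ?_ ?_ ?_ ?_ ?_ ?_ ?_ T x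
  · intro x
    have := hR'.norm_le x
    simpa [norm_smul, hσn] using this
  · intro t x
    simp [hW.resolvent_apply hR']
  · refine hA.dense_domain.mono ?_
    intro x hx
    obtain ⟨y, hy⟩ := LinearPMap.mem_domain_iff.1 hx
    exact ⟨_, hinv x y hy⟩
  · intro x
    have h1 := A.graph.smul_mem ((σ : ℂ) * Complex.I) (hR'.mem_graph x)
    have h2 := (hW.generator _ _).1 h1
    have h3 := hasDerivAt_comp_const_mul h2 σ
    refine h3.congr_deriv ?_
    rw [← Complex.coe_smul]
    change _ = (σ * Complex.I) • R' x - x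
    match_scalars
    · linear_combination (Complex.I ^ 2) * hσσ + Complex.I_sq
    · linear_combination (-σ * Complex.I ^ 3) * hσσ - σ * Complex.I * Complex.I_sq
  · rintro _ ⟨⟨x, y⟩, hp, rfl⟩
    have h := hasDerivAt_comp_const_mul (hD x y hp) σ
    refine h.congr_deriv ?_
    change _ = (σ * Complex.I) • y
    rw [mul_smul, Complex.coe_smul]
  · rintro _ ⟨⟨x, y⟩, hp, rfl⟩
    exact hinv x y (hDA hp)
  -- `1 - iσA` maps the graph onto the whole space, and the core is dense in the graph, so the image
  -- of the core is dense.
  · rw [Set.image_image]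
    intro z
    have hφ : Continuous fun p : E × E => p.1 - (σ * Complex.I) • p.2 := by fun_prop
    refine image_closure_subset_closure_image hφ ⟨((σ * Complex.I) • R' z,
      (σ * Complex.I) • (z - (σ * Complex.I) • R' z)), hAD ?_, ?_⟩
    · have h1 := A.graph.smul_mem ((σ : ℂ) * Complex.I) (hR'.mem_graph z)
      have h2 : z - (σ * Complex.I) • R' z = z + (((-σ : ℝ) : ℂ) * Complex.I) • R' z := by
        push_cast
        module
      rw [h2]
      exact h1
    · change (σ * Complex.I) • R' z -
        (σ * Complex.I) • (σ * Complex.I) • (z - (σ * Complex.I) • R' z) = z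
      match_scalars
      · linear_combination (σ * Complex.I ^ 3) * hσσ + σ * Complex.I * Complex.I_sq
      · linear_combination (-Complex.I ^ 2) * hσσ - Complex.I_sq

/-- Chernoff's product formula for unitary groups. -/
theorem tendstoUniformlyOn_pow_of_core {A : E →ₗ.[ℂ] E} (hA : IsSelfAdjoint A)
    {W : ℝ → E →L[ℂ] E} (hW : IsUnitaryGroupOf A W) {D : Set (E × E)}
    (hDA : D ⊆ A.graph) (hAD : (A.graph : Set (E × E)) ⊆ closure D) {F : ℝ → E →L[ℂ] E}
    (hF : ∀ h x, ‖F h x‖ ≤ ‖x‖) (hF0 : F 0 = 1)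
    (hD : ∀ x y, (x, y) ∈ D → HasDerivAt (fun h => F h x) (Complex.I • y) 0)
    {K : Set ℝ} (hK : IsCompact K) (x : E) :
    TendstoUniformlyOn (fun (n : ℕ) t => (F (t / n) ^ n) x) (fun t => W t x) atTop K := by
  obtain ⟨T, hT⟩ := hK.isBounded.subset_closedBall 0
  have h1 := tendstoUniformlyOn_pow_Icc_of_core hA hW hDA hAD hF hF0 hD (Or.inl rfl) T x
  have h2 := tendstoUniformlyOn_pow_Icc_of_core hA hW hDA hAD hF hF0 hD (Or.inr rfl) T x
  rw [Metric.tendstoUniformlyOn_iff] at h1 h2 ⊢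
  intro ε hε
  filter_upwards [h1 ε hε, h2 ε hε] with n hn1 hn2 t ht
  have h3 := hT ht
  rw [mem_closedBall_zero_iff, Real.norm_eq_abs, abs_le] at h3
  rcases le_total 0 t with h0 | h0
  · simpa using hn1 t ⟨h0, h3.2⟩
  · simpa [neg_div] using hn2 (-t) ⟨by linarith, by linarith⟩

omit [CompleteSpace E] in
-- A product rule under strong differentiability at the one vector `x`: in `U t (g t) - g 0 = (U t x
-- - x) + U t (g t - g 0)` the last quotient converges because the `U t` are contractions tending
-- strongly to `1`.
theorem hasDerivAt_apply_comp {U : ℝ → E →L[ℂ] E} (hU : ∀ t x, ‖U t x‖ ≤ ‖x‖) (hU0 : U 0 = 1)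
    (hUc : ∀ x, Continuous fun t => U t x) {g : ℝ → E} {x p q : E} (hg : HasDerivAt g p 0)
    (hg0 : g 0 = x) (hx : HasDerivAt (fun t => U t x) q 0) :
    HasDerivAt (fun t => U t (g t)) (q + p) 0 := by
  rw [hasDerivAt_iff_tendsto_slope_zero] at *
  have h1 : Tendsto (fun t : ℝ => U t (t⁻¹ • (g (0 + t) - g 0))) (𝓝[≠] 0) (𝓝 ((1 : E →L[ℂ] E) p)) := by
    refine tendsto_apply_of_tendsto hU (fun y => ?_) hg
    have := (hUc y).tendsto 0
    rw [hU0] at this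
    exact this.mono_left nhdsWithin_le_nhds
  have h2 := hx.add h1
  rw [one_apply_eq_self] at h2
  refine h2.congr fun t => ?_
  rw [← Complex.coe_smul, ← Complex.coe_smul, ← Complex.coe_smul, map_smul, map_sub, hg0, hU0]
  simp only [zero_add, one_apply_eq_self]
  module

/-- The derivative at `0` of a product of unitary groups on the intersection of the domains of
their generators. -/
theorem hasDerivAt_list_prod_apply {ι : Type*} {A : ι → E →ₗ.[ℂ] E} {W : ι → ℝ → E →L[ℂ] E}
    (hW : ∀ i, IsUnitaryGroupOf (A i) (W i)) (c : ℝ) {x : E} {y : ι → E}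
    (h : ∀ i, (x, y i) ∈ (A i).graph) (l : List ι) :
    HasDerivAt (fun t : ℝ => (l.map fun i => W i (t * c)).prod x)
      ((l.map fun i => (c : ℂ) • Complex.I • y i).sum) 0 := by
  induction l with
  | nil => simpa using hasDerivAt_const (0 : ℝ) x
  | cons i l ih =>
    simp only [List.map_cons, List.prod_cons, List.sum_cons, mul_apply_eq_comp]
    refine hasDerivAt_apply_comp (U := fun t => W i (t * c)) (x := x)
      (fun t z => ((hW i).norm_apply _ z).le) (by simpa using (hW i).map_zero)
      (fun z => ((hW i).continuous z).comp (by fun_prop)) ih ?_ ?_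
    · have : ∀ l : List ι, (l.map fun i => W i (0 * c)).prod = 1 := fun l => by
        simp [(hW _).map_zero]
      rw [this, one_apply_eq_self]
    · have h1 := hasDerivAt_comp_const_mul (((hW i).generator _ _).1 (h i)) c
      simpa only [mul_comm c, Complex.coe_smul] using h1

omit [CompleteSpace E] in
theorem norm_list_prod_apply_le {l : List (E →L[ℂ] E)} (h : ∀ U ∈ l, ∀ x, ‖U x‖ ≤ ‖x‖) (x : E) :
    ‖l.prod x‖ ≤ ‖x‖ := by
  induction l with
  | nil => simp
  | cons U l ih =>
    rw [List.prod_cons, mul_apply_eq_comp]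
    exact (h U (by simp) _).trans (ih fun V hV => h V (by simp [hV]))

end Trotter

/-! ### Real multiples of self-adjoint operators -/

section Scaling

variable {E : Type*} [NormedAddCommGroup E] [InnerProductSpace ℂ E] [CompleteSpace E]

theorem exists_isSelfAdjoint_mem_graph_iff_smul {S : E →ₗ.[ℂ] E} (hS : IsSelfAdjoint S) {c : ℝ}
    (hc : c ≠ 0) :
    ∃ C : E →ₗ.[ℂ] E, IsSelfAdjoint C ∧
      ∀ x y, (x, y) ∈ C.graph ↔ (x, (c : ℂ) • y) ∈ S.graph := by
  have hc' : (c : ℂ) ≠ 0 := by exact_mod_cast hc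
  have hg : ∀ x y, (x, y) ∈ ((c : ℂ)⁻¹ • S).graph ↔ (x, (c : ℂ) • y) ∈ S.graph := by
    intro x y
    simp only [LinearPMap.mem_graph_iff]
    constructor
    · rintro ⟨a, ha, hy⟩
      refine ⟨a, ha, ?_⟩
      change (c : ℂ)⁻¹ • S a = y at hy
      change S a = (c : ℂ) • y
      rw [← hy, smul_inv_smul₀ hc']
    · rintro ⟨a, ha, hy⟩
      refine ⟨a, ha, ?_⟩
      change S a = (c : ℂ) • y at hy
      change (c : ℂ)⁻¹ • S a = y
      rw [hy, inv_smul_smul₀ hc']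
  refine ⟨(c : ℂ)⁻¹ • S, isSelfAdjoint_of_mem_graph_iff hS.dense_domain fun x y => ?_, hg⟩
  rw [hg, mem_graph_iff_of_isSelfAdjoint hS]
  constructor
  · intro h a b hab
    have h1 := h _ _ ((hg a b).1 hab)
    rw [inner_smul_left, inner_smul_right, Complex.conj_ofReal] at h1
    exact mul_left_cancel₀ hc' h1
  · intro h a b hab
    have h1 := h a ((c : ℂ)⁻¹ • b) ((hg _ _).2 (by rwa [smul_inv_smul₀ hc']))
    rw [inner_smul_left, map_inv₀, Complex.conj_ofReal] at h1
    rw [inner_smul_right, ← h1, mul_inv_cancel_left₀ hc']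

end Scaling

/-! ### Operators of the form `1 ⊗ B` and invariance under `V` -/

section Tensor

variable {Hs He : Type*} [NormedAddCommGroup Hs] [InnerProductSpace ℂ Hs]
  [NormedAddCommGroup He] [InnerProductSpace ℂ He]

variable (He) in
/-- The contraction `a ⊗ y ↦ ⟪e, a⟫ y`. -/
noncomputable def contract (e : Hs) : Hs ⊗[ℂ] He →ₗ[ℂ] He :=
  (TensorProduct.lid ℂ He : ℂ ⊗[ℂ] He →ₗ[ℂ] He) ∘ₗ (innerₛₗ ℂ e).rTensor He

@[simp]
theorem contract_tmul (e a : Hs) (y : He) : contract He e (a ⊗ₜ y) = inner ℂ e a • y := by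
  simp [contract]

/-- The contraction is the adjoint of `y ↦ e ⊗ y`; density and self-adjointness pass from `Hs ⊗ He`
to `He` through this pair. -/
theorem inner_tmul_left_eq_inner_contract (e : Hs) (y : He) (ξ : Hs ⊗[ℂ] He) :
    inner ℂ (e ⊗ₜ[ℂ] y) ξ = inner ℂ y (contract He e ξ) := by
  induction ξ using TensorProduct.induction_on with
  | zero => simp
  | tmul a z => simp
  | add ξ η hξ hη => rw [inner_add_right, hξ, hη, map_add, inner_add_right]

theorem inner_tmul_right_eq_inner_contract (e : Hs) (y : He) (ξ : Hs ⊗[ℂ] He) :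
    inner ℂ ξ (e ⊗ₜ[ℂ] y) = inner ℂ (contract He e ξ) y := by
  rw [← inner_conj_symm ξ, inner_tmul_left_eq_inner_contract, inner_conj_symm]

theorem sum_tmul_contract {ι : Type*} [Fintype ι] (b : OrthonormalBasis ι ℂ Hs)
    (ξ : Hs ⊗[ℂ] He) : ∑ i, b i ⊗ₜ[ℂ] contract He (b i) ξ = ξ := by
  induction ξ using TensorProduct.induction_on with
  | zero => simp
  | tmul a z =>
    simp only [contract_tmul, ← TensorProduct.smul_tmul, ← TensorProduct.sum_tmul]
    rw [b.sum_repr']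
  | add ξ η hξ hη =>
    simp only [map_add, TensorProduct.tmul_add, Finset.sum_add_distrib, hξ, hη]

theorem mem_graph_oneTensor_iff (B : He →ₗ.[ℂ] He) (ξ η : Hs ⊗[ℂ] He) :
    (ξ, η) ∈ (oneTensor Hs B).graph ↔ ∃ ζ : Hs ⊗[ℂ] B.domain,
      B.domain.subtype.lTensor Hs ζ = ξ ∧ B.toFun.lTensor Hs ζ = η := by
  have hinj := Module.Flat.lTensor_preserves_injective_linearMap (M := Hs) B.domain.subtype
        B.domain.injective_subtype
  have key : ∀ ζ, ∀ h : B.domain.subtype.lTensor Hs ζ ∈ (oneTensor Hs B).domain,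
      oneTensor Hs B ⟨_, h⟩ = B.toFun.lTensor Hs ζ := by
    intro ζ h
    change B.toFun.lTensor Hs ((LinearEquiv.ofInjective _ hinj).symm ⟨_, h⟩) = _
    congr 1
    rw [LinearEquiv.symm_apply_eq]
    rfl
  rw [LinearPMap.mem_graph_iff]
  constructor
  · rintro ⟨⟨_, ζ, rfl⟩, rfl, rfl⟩
    exact ⟨ζ, rfl, (key ζ _).symm⟩
  · rintro ⟨ζ, rfl, rfl⟩
    exact ⟨⟨_, ζ, rfl⟩, rfl, key ζ _⟩

theorem tmul_mem_graph_oneTensor {B : He →ₗ.[ℂ] He} (a : Hs) {y z : He}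
    (h : (y, z) ∈ B.graph) : (a ⊗ₜ[ℂ] y, a ⊗ₜ[ℂ] z) ∈ (oneTensor Hs B).graph := by
  obtain ⟨y', rfl, rfl⟩ := (LinearPMap.mem_graph_iff _).1 h
  rw [mem_graph_oneTensor_iff]
  exact ⟨a ⊗ₜ y', rfl, rfl⟩

/-- A self-adjoint operator whose graph is invariant under all `|a⟩⟨b| ⊗ 1` is of the form
`1 ⊗ B`. -/
theorem exists_oneTensor_eq [FiniteDimensional ℂ Hs] [CompleteSpace He]
    {C : (Hs ⊗[ℂ] He) →ₗ.[ℂ] (Hs ⊗[ℂ] He)} (hC : IsSelfAdjoint C)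
    (hinv : ∀ (a b : Hs) (ξ η : Hs ⊗[ℂ] He), (ξ, η) ∈ C.graph →
      (a ⊗ₜ[ℂ] contract He b ξ, a ⊗ₜ[ℂ] contract He b η) ∈ C.graph) :
    ∃ B : He →ₗ.[ℂ] He, IsSelfAdjoint B ∧ oneTensor Hs B = C := by
  rcases subsingleton_or_nontrivial Hs with hs | hs
  -- If `Hs = 0` the tensor product is trivial and any self-adjoint `B` serves.
  · refine ⟨LinearMap.toPMap 0 ⊤, ?_, ?_⟩
    · refine isSelfAdjoint_of_mem_graph_iff (by simp [LinearMap.toPMap]) fun x y => ?_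
      have hg : ∀ x y : He, (x, y) ∈ (LinearMap.toPMap (0 : He →ₗ[ℂ] He) ⊤).graph ↔ y = 0 := by
        intro x y
        rw [LinearPMap.mem_graph_iff]
        exact ⟨fun ⟨_, _, h⟩ => h.symm, fun h => ⟨⟨x, trivial⟩, rfl, h.symm⟩⟩
      simp only [hg]
      constructor
      · rintro rfl a b rfl
        simp
      · intro h
        simpa using (h y 0 rfl).symm
    · refine LinearPMap.eq_of_eq_graph ?_
      ext p
      rw [Subsingleton.elim p 0]
      simp only [zero_mem]
  obtain ⟨e, he⟩ := exists_norm_eq Hs zero_le_one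
  have hee : inner ℂ e e = (1 : ℂ) := by simp [inner_self_eq_norm_sq_to_K, he]
  have hcon : ∀ y : He, contract He e (e ⊗ₜ[ℂ] y) = y := fun y => by
    rw [contract_tmul, hee, one_smul]
  let g : Submodule ℂ (He × He) :=
    C.graph.comap ((TensorProduct.mk ℂ Hs He e).prodMap (TensorProduct.mk ℂ Hs He e))
  have hg : ∀ y z, (y, z) ∈ g ↔ (e ⊗ₜ[ℂ] y, e ⊗ₜ[ℂ] z) ∈ C.graph := fun _ _ => Iff.rfl
  have hg0 : ∀ x ∈ g, x.1 = 0 → x.2 = 0 := by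
    rintro ⟨y, z⟩ hyz (rfl : y = 0)
    rw [hg, TensorProduct.tmul_zero] at hyz
    have h := C.graph_fst_eq_zero_snd hyz rfl
    have h1 := hcon z
    rw [h, map_zero] at h1
    exact h1.symm
  have hB : ∀ y z, (y, z) ∈ g.toLinearPMap.graph ↔ (e ⊗ₜ[ℂ] y, e ⊗ₜ[ℂ] z) ∈ C.graph := by
    intro y z
    rw [Submodule.toLinearPMap_graph_eq g hg0, hg]
  have hcontr : ∀ b ξ η, (ξ, η) ∈ C.graph →
      (contract He b ξ, contract He b η) ∈ g.toLinearPMap.graph := fun b ξ η h => by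
    rw [hB]
    exact hinv e b ξ η h
  refine ⟨g.toLinearPMap, isSelfAdjoint_of_mem_graph_iff ?_ fun y z => ?_, ?_⟩
  · rw [Submodule.dense_iff_topologicalClosure_eq_top, Submodule.topologicalClosure_eq_top_iff,
      Submodule.eq_bot_iff]
    intro y hy
    rw [Submodule.mem_orthogonal] at hy
    -- The contraction by `e` maps the domain of `C` into that of `B`, so `y ⊥ 𝒟(B)` implies `e ⊗ y
    -- ⊥ 𝒟(C)`.
    have h1 : e ⊗ₜ[ℂ] y = 0 := by
      refine hC.dense_domain.eq_zero_of_inner_right ℂ fun ξ hξ => ?_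
      obtain ⟨η, hη⟩ := LinearPMap.mem_domain_iff.1 hξ
      rw [inner_tmul_right_eq_inner_contract]
      exact hy _ (LinearPMap.mem_domain_of_mem_graph (hcontr e ξ η hη))
    rw [← hcon y, h1, map_zero]
  · rw [hB, mem_graph_iff_of_isSelfAdjoint hC]
    constructor
    · intro h a b hab
      have h1 := h _ _ ((hB _ _).1 hab)
      rwa [TensorProduct.inner_tmul, TensorProduct.inner_tmul, hee, one_mul, one_mul] at h1
    · intro h ξ η hξη
      rw [inner_tmul_right_eq_inner_contract, inner_tmul_right_eq_inner_contract]
      exact h _ _ (hcontr e ξ η hξη)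
  · refine LinearPMap.eq_of_eq_graph ?_
    ext ⟨ξ, η⟩
    constructor
    · rw [mem_graph_oneTensor_iff]
      rintro ⟨ζ, rfl, rfl⟩
      induction ζ using TensorProduct.induction_on with
      | zero => simp [map_zero, ← Prod.zero_eq_mk]
      | tmul a y =>
        -- The operator `|a⟩⟨e| ⊗ 1` moves `e ⊗ y` to `a ⊗ y`.
        have h1 := hinv a e _ _ ((hB _ _).1 (g.toLinearPMap.mem_graph y))
        rw [hcon, hcon] at h1
        exact h1
      | add ζ ζ' h h' =>
        rw [map_add, map_add]
        exact C.graph.add_mem h h'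
    · intro h
      let b := stdOrthonormalBasis ℂ Hs
      have h1 := Submodule.sum_mem (oneTensor Hs g.toLinearPMap).graph
        fun i (_ : i ∈ Finset.univ) => tmul_mem_graph_oneTensor (b i) (hcontr (b i) ξ η h)
      rw [← sum_tmul_contract b ξ, ← sum_tmul_contract b η]
      convert h1 using 1
      rw [Prod.ext_iff, Prod.fst_sum, Prod.snd_sum]
      exact ⟨rfl, rfl⟩

variable {V : Subgroup (Hs ≃ₗᵢ[ℂ] Hs)} [Fintype V]

/-- The group of a decoupling set spans all rank one operators. -/
theorem IsDecouplingSet.sum_inner_smul [FiniteDimensional ℂ Hs] (hV : IsDecouplingSet V) (a b w : Hs) :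
    (Module.finrank ℂ Hs * (Fintype.card V : ℂ)⁻¹) • ∑ v : V, inner ℂ (v.1 b) a • v.1 w =
      inner ℂ b w • a := by
  rcases subsingleton_or_nontrivial Hs with hs | hs
  · exact Subsingleton.elim _ _
  -- The decoupling identity for `x = |w⟩⟨b|`, of trace `⟪b, w⟫`, evaluated at `a`: here `v x v* a =
  -- ⟪v b, a⟫ v w`.
  have h := LinearMap.congr_fun (hV ((innerₛₗ ℂ b).smulRight w)) a
  have hd : (Module.finrank ℂ Hs : ℂ) ≠ 0 := by
    exact_mod_cast (Module.finrank_pos (R := ℂ) (M := Hs)).ne'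
  have htr : LinearMap.trace ℂ Hs ((innerₛₗ ℂ b).smulRight w) = inner ℂ b w := by
    simp
  have h2 : ∀ v : V, inner ℂ b (v.1⁻¹ a) = inner ℂ (v.1 b) a := fun v => by
    rw [← LinearIsometryEquiv.inner_map_map v.1 b (v.1⁻¹ a)]
    congr 1
    exact v.1.apply_symm_apply a
  rw [htr] at h
  simp only [LinearMap.smul_apply, LinearMap.sum_apply, LinearMap.comp_apply,
    LinearMap.smulRight_apply, LinearMap.id_apply] at h
  have h3 : ∀ v : V, (v.1.toLinearEquiv : Hs →ₗ[ℂ] Hs)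
      ((innerₛₗ ℂ b) (((v.1⁻¹).toLinearEquiv : Hs →ₗ[ℂ] Hs) a) • w) =
      inner ℂ (v.1 b) a • v.1 w := fun v => by
    rw [map_smul, ← h2]
    rfl
  simp only [h3] at h
  rw [mul_smul, h, smul_smul, mul_inv_cancel_left₀ hd]

variable (He) in
/-- `v ⊗ 1` as a linear map. -/
noncomputable def actSys (v : Hs ≃ₗᵢ[ℂ] Hs) : Hs ⊗[ℂ] He →ₗ[ℂ] Hs ⊗[ℂ] He :=
  (v.toLinearEquiv : Hs →ₗ[ℂ] Hs).rTensor He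

theorem actSys_mul_apply (v w : Hs ≃ₗᵢ[ℂ] Hs) (ξ : Hs ⊗[ℂ] He) :
    actSys He (v * w) ξ = actSys He v (actSys He w ξ) :=
  LinearMap.rTensor_comp_apply He (v.toLinearEquiv : Hs →ₗ[ℂ] Hs)
    (w.toLinearEquiv : Hs →ₗ[ℂ] Hs) ξ

theorem continuous_actSys (v : Hs ≃ₗᵢ[ℂ] Hs) : Continuous (actSys He v) :=
  (v.rTensor He).continuous

theorem mem_graph_conjSys_iff (v : Hs ≃ₗᵢ[ℂ] Hs) (H : (Hs ⊗[ℂ] He) →ₗ.[ℂ] (Hs ⊗[ℂ] He))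
    (ξ η : Hs ⊗[ℂ] He) :
    (ξ, η) ∈ (conjSys v H).graph ↔ (actSys He v⁻¹ ξ, actSys He v⁻¹ η) ∈ H.graph := by
  rw [conjSys, mem_graph_conj_iff, LinearIsometryEquiv.symm_rTensor]
  rfl

theorem mem_graph_conjSum_iff (H : (Hs ⊗[ℂ] He) →ₗ.[ℂ] (Hs ⊗[ℂ] He)) (ξ η : Hs ⊗[ℂ] He) :
    (ξ, η) ∈ (conjSum V H).graph ↔ ∃ f : V → Hs ⊗[ℂ] He,
      (∀ v, (ξ, f v) ∈ (conjSys v.1 H).graph) ∧ ∑ v, f v = η := by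
  have happ : ∀ x, conjSum V H x = ∑ v : V, conjSys v.1 H
      (Submodule.inclusion (iInf_le (fun v : V => (conjSys v.1 H).domain) v) x) := fun x =>
    LinearMap.sum_apply Finset.univ (fun v : V => (conjSys v.1 H).toFun ∘ₗ
      Submodule.inclusion (iInf_le (fun v : V => (conjSys v.1 H).domain) v)) x
  rw [LinearPMap.mem_graph_iff]
  constructor
  · rintro ⟨x, rfl, rfl⟩
    exact ⟨_, fun v => (conjSys v.1 H).mem_graph
      (Submodule.inclusion (iInf_le (fun v : V => (conjSys v.1 H).domain) v) x), (happ x).symm⟩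
  · rintro ⟨f, hf, rfl⟩
    refine ⟨⟨ξ, (Submodule.mem_iInf _).2 fun v => LinearPMap.mem_domain_of_mem_graph (hf v)⟩,
      rfl, ?_⟩
    rw [happ]
    refine Finset.sum_congr rfl fun v _ => ?_
    exact LinearPMap.mem_graph_snd_inj _ (LinearPMap.mem_graph _ _) (hf v) rfl

/-- Because `w (v H v*) w* = (w v) H (w v)*`, left translation by `w` permutes the summands. -/
theorem actSys_mem_graph_conjSum {H : (Hs ⊗[ℂ] He) →ₗ.[ℂ] (Hs ⊗[ℂ] He)} (w : V)
    {ξ η : Hs ⊗[ℂ] He} (h : (ξ, η) ∈ (conjSum V H).graph) :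
    (actSys He w.1 ξ, actSys He w.1 η) ∈ (conjSum V H).graph := by
  rw [mem_graph_conjSum_iff] at h ⊢
  obtain ⟨f, hf, rfl⟩ := h
  refine ⟨fun v => actSys He w.1 (f (w⁻¹ * v)), fun v => ?_, ?_⟩
  · have h1 := (mem_graph_conjSys_iff _ _ _ _).1 (hf (w⁻¹ * v))
    have h2 : ((w⁻¹ * v : V) : Hs ≃ₗᵢ[ℂ] Hs)⁻¹ = v.1⁻¹ * w.1 := by simp
    rw [h2, actSys_mul_apply, actSys_mul_apply] at h1
    rwa [mem_graph_conjSys_iff]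
  · rw [← map_sum]
    congr 1
    exact Fintype.sum_equiv (Equiv.mulLeft w⁻¹) _ _ fun v => rfl

theorem actSys_mem_graph_closure {H : (Hs ⊗[ℂ] He) →ₗ.[ℂ] (Hs ⊗[ℂ] He)}
    (hc : (conjSum V H).IsClosable) (w : V) {ξ η : Hs ⊗[ℂ] He}
    (h : (ξ, η) ∈ (conjSum V H).closure.graph) :
    (actSys He w.1 ξ, actSys He w.1 η) ∈ (conjSum V H).closure.graph := by
  rw [← hc.graph_closure_eq_closure_graph] at h ⊢
  have hcont : Continuous fun p : (Hs ⊗[ℂ] He) × (Hs ⊗[ℂ] He) =>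
      (actSys He w.1 p.1, actSys He w.1 p.2) :=
    ((continuous_actSys w.1).comp continuous_fst).prodMk
      ((continuous_actSys w.1).comp continuous_snd)
  exact map_mem_closure (f := fun p : (Hs ⊗[ℂ] He) × (Hs ⊗[ℂ] He) =>
    (actSys He w.1 p.1, actSys He w.1 p.2)) hcont h fun p hp => actSys_mem_graph_conjSum w hp

theorem IsDecouplingSet.sum_inner_smul_actSys [FiniteDimensional ℂ Hs] (hV : IsDecouplingSet V) (a b : Hs)
    (ξ : Hs ⊗[ℂ] He) :
    (Module.finrank ℂ Hs * (Fintype.card V : ℂ)⁻¹) •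
      ∑ v : V, inner ℂ (v.1 b) a • actSys He v.1 ξ = a ⊗ₜ[ℂ] contract He b ξ := by
  induction ξ using TensorProduct.induction_on with
  | zero => simp
  | tmul w y =>
    have h1 : ∀ v : V, actSys He v.1 (w ⊗ₜ[ℂ] y) = v.1 w ⊗ₜ[ℂ] y := fun v => rfl
    simp only [h1, TensorProduct.smul_tmul']
    rw [← TensorProduct.sum_tmul, TensorProduct.smul_tmul', hV.sum_inner_smul, contract_tmul,
      TensorProduct.smul_tmul]
  | add ξ η hξ hη =>
    simp only [map_add, smul_add, Finset.sum_add_distrib, TensorProduct.tmul_add, hξ, hη]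

/-- A subspace invariant under `V` is invariant under the linear span of `V`, which contains every
`|a⟩⟨b|`. -/
theorem IsDecouplingSet.tmul_contract_mem [FiniteDimensional ℂ Hs] (hV : IsDecouplingSet V)
    {G : Submodule ℂ ((Hs ⊗[ℂ] He) × (Hs ⊗[ℂ] He))}
    (hG : ∀ (v : V) ξ η, (ξ, η) ∈ G → (actSys He v.1 ξ, actSys He v.1 η) ∈ G)
    (a b : Hs) {ξ η : Hs ⊗[ℂ] He} (h : (ξ, η) ∈ G) :
    (a ⊗ₜ[ℂ] contract He b ξ, a ⊗ₜ[ℂ] contract He b η) ∈ G := by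
  have h1 := G.smul_mem (Module.finrank ℂ Hs * (Fintype.card V : ℂ)⁻¹)
    (G.sum_mem fun (v : V) (_ : v ∈ Finset.univ) => G.smul_mem (inner ℂ (v.1 b) a) (hG v ξ η h))
  rw [← hV.sum_inner_smul_actSys, ← hV.sum_inner_smul_actSys]
  convert h1 using 1
  rw [Prod.ext_iff, Prod.smul_fst, Prod.smul_snd, Prod.fst_sum, Prod.snd_sum]
  exact ⟨rfl, rfl⟩

end Tensor

/-! ### Trotter's formula along a cycle -/

section Average

theorem sum_comp_of_card_fiber_eq {ι : Type*} [Fintype ι] {N : ℕ} {c : Fin N → ι} {m : ℕ}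
    (hm : ∀ i : ι, Nat.card {k : Fin N // c k = i} = m) {M : Type*} [AddCommMonoid M]
    (f : ι → M) : ∑ k, f (c k) = m • ∑ i, f i := by
  classical
  rw [← Finset.sum_fiberwise Finset.univ c, Finset.smul_sum]
  refine Finset.sum_congr rfl fun v _ => ?_
  rw [Finset.sum_congr rfl fun k hk => congrArg f (Finset.mem_filter.1 hk).2, Finset.sum_const,
    ← hm v, Nat.card_eq_fintype_card, Fintype.card_subtype]

variable {E ι : Type*} [NormedAddCommGroup E] [InnerProductSpace ℂ E] [CompleteSpace E]
  [Fintype ι]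

/-- Trotter's product formula: products along a cycle that reaches each index `m` times converge to
the group generated by the average of the generators. -/
theorem tendstoUniformlyOn_list_prod_pow [Nonempty ι] {A : ι → E →ₗ.[ℂ] E}
    {W : ι → ℝ → E →L[ℂ] E} (hW : ∀ i, IsUnitaryGroupOf (A i) (W i)) {S C : E →ₗ.[ℂ] E}
    (hS : ∀ x y, (x, y) ∈ S.graph → ∃ f : ι → E, (∀ i, (x, f i) ∈ (A i).graph) ∧ ∑ i, f i = y)
    (hcl : S.IsClosable) (hC : IsSelfAdjoint C)
    (hCS : ∀ x y, (x, y) ∈ C.graph ↔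
      (x, ((Fintype.card ι : ℝ) : ℂ) • y) ∈ S.closure.graph)
    {U : ℝ → E →L[ℂ] E} (hU : IsUnitaryGroupOf C U) {N : ℕ} {c : Fin N → ι} {m : ℕ} (hm0 : 0 < m)
    (hm : ∀ i : ι, Nat.card {k : Fin N // c k = i} = m) (ξ : E) {K : Set ℝ} (hK : IsCompact K) :
    TendstoUniformlyOn (fun (n : ℕ) (t : ℝ) =>
        (((List.ofFn c).map fun i => W i (t / n * (N : ℝ)⁻¹)).prod ^ n) ξ)
      (fun t => U t ξ) atTop K := by
  have hN : N = m * Fintype.card ι := by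
    simpa using sum_comp_of_card_fiber_eq hm fun _ => (1 : ℕ)
  have hd0 : (Fintype.card ι : ℂ) ≠ 0 := by exact_mod_cast Fintype.card_ne_zero
  have hm0' : (m : ℂ) ≠ 0 := by exact_mod_cast hm0.ne'
  -- Rescaling by `φ` turns the graph of the sum into that of the average; its image is the core for
  -- `C`.
  let φ : E × E → E × E := fun p => (p.1, (Fintype.card ι : ℂ)⁻¹ • p.2)
  have hφ : Continuous φ := by fun_prop
  refine tendstoUniformlyOn_pow_of_core
    (F := fun h => ((List.ofFn c).map fun i => W i (h * (N : ℝ)⁻¹)).prod) hC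
    hU (D := φ '' S.graph) ?_ ?_ ?_ ?_ ?_ hK ξ
  · rintro _ ⟨⟨x, y⟩, hp, rfl⟩
    have h := LinearPMap.le_graph_of_le S.le_closure hp
    change (x, (Fintype.card ι : ℂ)⁻¹ • y) ∈ C.graph
    rw [hCS, Complex.ofReal_natCast, smul_inv_smul₀ hd0]
    exact h
  · rintro ⟨x, y⟩ h
    have h1 := (hCS x y).1 h
    rw [← hcl.graph_closure_eq_closure_graph] at h1
    have h2 := image_closure_subset_closure_image hφ ⟨_, h1, rfl⟩
    simpa [φ, inv_smul_smul₀ hd0] using h2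
  · intro h x
    refine norm_list_prod_apply_le (fun U hU x => ?_) x
    obtain ⟨i, _, rfl⟩ := List.mem_map.1 hU
    exact ((hW i).norm_apply _ x).le
  · refine List.prod_eq_one fun U hU => ?_
    obtain ⟨i, _, rfl⟩ := List.mem_map.1 hU
    simp [(hW i).map_zero]
  · rintro _ _ ⟨⟨x, y⟩, hp, h⟩
    obtain ⟨rfl, rfl⟩ := Prod.ext_iff.1 h
    obtain ⟨f, hf, rfl⟩ := hS x y hp
    refine (hasDerivAt_list_prod_apply hW (N : ℝ)⁻¹ hf (List.ofFn c)).congr_deriv ?_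
    rw [List.map_ofFn, List.sum_ofFn]
    change ∑ k, (((N : ℝ)⁻¹ : ℝ) : ℂ) • Complex.I • f (c k) =
      Complex.I • (Fintype.card ι : ℂ)⁻¹ • ∑ i, f i
    -- Each index contributes `m / N`, which is `1 / card ι` because `N = m * card ι`.
    rw [sum_comp_of_card_fiber_eq hm fun i => (((N : ℝ)⁻¹ : ℝ) : ℂ) • Complex.I • f i,
      ← Finset.smul_sum, ← Finset.smul_sum, ← Nat.cast_smul_eq_nsmul ℂ, smul_smul, smul_smul,
      smul_smul, hN]
    congr 1
    push_cast
    field_simp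

end Average

/-! ### Convergence of the decoupling products -/

section Convergence

variable {Hs He : Type*} [NormedAddCommGroup Hs] [InnerProductSpace ℂ Hs] [FiniteDimensional ℂ Hs]
  [NormedAddCommGroup He] [InnerProductSpace ℂ He] [CompleteSpace He]
  {V : Subgroup (Hs ≃ₗᵢ[ℂ] Hs)}

theorem isUnitaryGroupOf_expI_conjSys (v : Hs ≃ₗᵢ[ℂ] Hs)
    {H : (Hs ⊗[ℂ] He) →ₗ.[ℂ] (Hs ⊗[ℂ] He)} (hH : IsSelfAdjoint H) :
    IsUnitaryGroupOf (conjSys v H) (expI (conjSys v H)) := by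
  obtain ⟨U, hU⟩ := exists_isUnitaryGroupOf hH
  exact isUnitaryGroupOf_expI ⟨_, hU.conj (v.rTensor He)⟩

theorem decouplingProduct_eq (H : (Hs ⊗[ℂ] He) →ₗ.[ℂ] (Hs ⊗[ℂ] He)) {N : ℕ} (c : Fin N → V)
    (n : ℕ) (t : ℝ) :
    decouplingProduct H c n t =
      ((List.ofFn c).map fun v => expI (conjSys v.1 H) (t / n * (N : ℝ)⁻¹)).prod ^ n := by
  rw [decouplingProduct, List.map_ofFn, div_mul_eq_div_div, div_eq_mul_inv (t / n)]
  rfl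

theorem tendstoUniformlyOn_decouplingProduct [Fintype V]
    {H C : (Hs ⊗[ℂ] He) →ₗ.[ℂ] (Hs ⊗[ℂ] He)}
    (hH : IsSelfAdjoint H) (hcl : (conjSum V H).IsClosable) (hC : IsSelfAdjoint C)
    (hCS : ∀ x y, (x, y) ∈ C.graph ↔
      (x, ((Fintype.card V : ℝ) : ℂ) • y) ∈ (conjSum V H).closure.graph)
    {N : ℕ} {c : Fin N → V} (hc : IsDecouplingCycle V c) (ξ : Hs ⊗[ℂ] He) {K : Set ℝ}
    (hK : IsCompact K) :
    TendstoUniformlyOn (fun (n : ℕ) (t : ℝ) => decouplingProduct H c n t ξ)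
      (fun t => expI C t ξ) atTop K := by
  obtain ⟨m, hm0, hm⟩ := hc
  simp only [decouplingProduct_eq]
  exact tendstoUniformlyOn_list_prod_pow (fun v : V => isUnitaryGroupOf_expI_conjSys v.1 hH)
    (fun x y => (mem_graph_conjSum_iff H x y).1) hcl hC hCS
    (isUnitaryGroupOf_expI (exists_isUnitaryGroupOf hC)) hm0 hm ξ hK

end Convergence

end DynamicalDecoupling

theorem theorem3p1 {Hs He : Type*}
    [NormedAddCommGroup Hs] [InnerProductSpace ℂ Hs] [FiniteDimensional ℂ Hs]
    [NormedAddCommGroup He] [InnerProductSpace ℂ He] [CompleteSpace He]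
    (V : Subgroup (Hs ≃ₗᵢ[ℂ] Hs)) [Fintype V] (hV : DynamicalDecoupling.IsDecouplingSet V)
    (H : (Hs ⊗[ℂ] He) →ₗ.[ℂ] (Hs ⊗[ℂ] He)) (hH : IsSelfAdjoint H)
    (hsum : DynamicalDecoupling.IsEssentiallySelfAdjoint (DynamicalDecoupling.conjSum V H)) :
    DynamicalDecoupling.WorksUniformly V H := by
  obtain ⟨hcl, hS⟩ := hsum
  obtain ⟨C, hC, hCS⟩ := DynamicalDecoupling.exists_isSelfAdjoint_mem_graph_iff_smul hS
    (c := (Fintype.card V : ℝ)) (by exact_mod_cast Fintype.card_ne_zero)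
  have hinv : ∀ (v : V) ξ η, (ξ, η) ∈ C.graph →
      (DynamicalDecoupling.actSys He v.1 ξ, DynamicalDecoupling.actSys He v.1 η) ∈ C.graph := by
    intro v ξ η h
    rw [hCS] at h ⊢
    rw [← map_smul]
    exact DynamicalDecoupling.actSys_mem_graph_closure hcl v h
  obtain ⟨B, hB, rfl⟩ := DynamicalDecoupling.exists_oneTensor_eq hC
    fun a b ξ η h => hV.tmul_contract_mem hinv a b h
  exact ⟨B, hB, fun N c hc ξ K hK =>
    DynamicalDecoupling.tendstoUniformlyOn_decouplingProduct hH hcl hC hCS hc ξ hK⟩
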